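/- Let $A$ be an $n\times n$ matrix with nonnegative entries (e.g. the adjacency matrix of a web graph), let $\tfrac12<\alpha<1$, and let $$A'=\begin{bmatrix}A&1\\1^T&0\end{bmatrix}$$ be the $(n+1)\times(n+1)$ matrix obtained by adding an artificial node linked to and from all pages. A primal feasible flow is a matrix $\rho=(\rho_{i,j})_{i,j\in[n+1]}\ge 0$ with $\sum_j\rho_{i,j}=\sum_j\rho_{j,i}$ for all $i$, $\sum_{i,j}\rho_{i,j}=1$ and $\sum_{j\le n}\rho_{n+1,j}=1-\alpha=\sum_{i\le n}\rho_{i,n+1}$. For $p\in\mathbb R^{n+1}$ and $\lambda=(\mu,a,b)\in\mathbb R^3$ let $$\theta(p,\mu,a,b)=\sum_{i,j\le n}A_{ij}e^{p_i-p_j+\mu}+\sum_{i\le n}e^{-b-p_{n+1}+p_i+\mu}+\sum_{j\le n}e^{a+p_{n+1}-p_j+\mu}-(1-\alpha)a-\mu+(1-\alpha)b$$ be the dual function, let $\lambda(p)$ be the minimizer of $\theta(p,\cdot)$ (unique when $A\neq0$), and call $y\in\mathbb R^n$, $y>0$, a HOTS vector if there are $p_{n+1}\in\mathbb R$ and $\lambda\in\mathbb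 R^3$ such that $((\log y,p_{n+1}),\lambda)$ minimizes $\theta$ over $\mathbb R^{n+1}\times\mathbb R^3$. For $i\le n$ let $$f^\lambda_i(p)=\tfrac12\Big(\log\big(\textstyle\sum_{j\le n}A_{j,i}e^{p_j}+e^{p_{n+1}+a}\big)-\log\big(\sum_{k\le n}A_{i,k}e^{-p_k}+e^{-p_{n+1}-b}\big)\Big),\qquad g^\lambda=\exp\circ f^\lambda\circ\log .$$ For $A\ne 0$ the vector $f^{\lambda(p)}(p)\in\mathbb R^n$ does not depend on $p_{n+1}$, so $F(p)=f^{\lambda(p)}(p)$ is regarded as a map $F:\mathbb R^n\to\mathbb R^n$ (take $p_{n+1}=0$), and likewise $y\mapsto g^{\lambda(\log y)}(y)$ as a map of $(0,\infty)^n$ (take $y_{n+1}=1$). **Theorem 4.2.** Suppose there is a primal feasible flow with the same sparsity pattern as $A'$. Then: 1. A HOTS vector exists, and it is unique up to a multiplicative constant: if $y$ is a HOTS vector, the HOTS vectors are exactly the vectors $cy$ with $c>0$. Moreover, $e^{p}$ is a HOTS vector if and only if $F(p)=p$. 2. For every initial point $y^0\in(0,\infty)^n$, the iterates $y^{k+1}=g^{\lambda(\log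 y^k)}(y^k)$ of the effective HOTS algorithm converge to a HOTS vector $e^{p^*}$, $F$ is differentiable at $p^*$, and the convergence is linear at rate $$\rho=|\lambda_2(\nabla F(p^*))|=\max\{|\lambda|:\lambda\in\mathrm{spectrum}(\nabla F(p^*)),\ \lambda\neq1\}$$ (complex spectrum; $\rho=0$ if there is no such $\lambda$), that is, $\rho<1$ and $\limsup_{k\to\infty}\|y^k-e^{p^*}\|^{1/k}\le\rho$. -/

import Mathlib

open Filter Topology

noncomputable section

namespace Hots

/-- A family indexed by the `n` pages together with the artificial node (index `Sum.inr ()`). -/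
abbrev NodeVec (n : ℕ) : Type := Fin n ⊕ Unit → ℝ

/-- The augmented matrix `A' = [A, 1; 1ᵀ, 0]`: an artificial node is linked to and from all pages. -/
def augmented {n : ℕ} (A : Matrix (Fin n) (Fin n) ℝ) :
    Matrix (Fin n ⊕ Unit) (Fin n ⊕ Unit) ℝ :=
  Matrix.fromBlocks A (fun _ _ => 1) (fun _ _ => 1) 0

/-- Feasible points of the primal network flow problem: nonnegative circulations on `n + 1` nodes
of total mass `1` that send mass `1 - α` out of and into the artificial node. -/
structure IsFeasibleFlow {n : ℕ} (α : ℝ) (ρ : Matrix (Fin n ⊕ Unit) (Fin n ⊕ Unit) ℝ) : Prop where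
  nonneg : ∀ i j, 0 ≤ ρ i j
  balance : ∀ i, ∑ j, ρ i j = ∑ j, ρ j i
  total : ∑ i, ∑ j, ρ i j = 1
  out_artificial : ∑ j : Fin n, ρ (Sum.inr ()) (Sum.inl j) = 1 - α
  in_artificial : ∑ i : Fin n, ρ (Sum.inl i) (Sum.inr ()) = 1 - α

/-- Two matrices have the same sparsity pattern. -/
def SamePattern {m : Type*} (M N : Matrix m m ℝ) : Prop :=
  ∀ i j, M i j ≠ 0 ↔ N i j ≠ 0

/-- The dual function `θ(p, μ, a, b)`; the multipliers are `l = (μ, a, b)`. -/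
def theta {n : ℕ} (A : Matrix (Fin n) (Fin n) ℝ) (α : ℝ) (p : NodeVec n) (l : ℝ × ℝ × ℝ) : ℝ :=
  (∑ i : Fin n, ∑ j : Fin n, A i j * Real.exp (p (Sum.inl i) - p (Sum.inl j) + l.1))
    + (∑ i : Fin n, Real.exp (-l.2.2 - p (Sum.inr ()) + p (Sum.inl i) + l.1))
    + (∑ j : Fin n, Real.exp (l.2.1 + p (Sum.inr ()) - p (Sum.inl j) + l.1))
    - (1 - α) * l.2.1 - l.1 + (1 - α) * l.2.2

/-- `λ(p)`: the minimizer of `θ(p, ·)` over `(μ, a, b)`. It exists and is unique when `A ≥ 0`,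
`A ≠ 0` and `1/2 < α < 1`, see `multipliers_eq` and `theta_lt` below. -/
def multipliers {n : ℕ} (A : Matrix (Fin n) (Fin n) ℝ) (α : ℝ) (p : NodeVec n) : ℝ × ℝ × ℝ :=
  Classical.epsilon fun l => IsMinOn (theta A α p) Set.univ l

/-- The fixed point operator `f^λ`, for `λ = l = (μ, a, b)`. -/
def fOp {n : ℕ} (A : Matrix (Fin n) (Fin n) ℝ) (l : ℝ × ℝ × ℝ) (p : NodeVec n) : Fin n → ℝ :=
  fun i => (1 / 2 : ℝ) *
    (Real.log ((∑ j : Fin n, A j i * Real.exp (p (Sum.inl j))) + Real.exp (p (Sum.inr ()) + l.2.1))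
      - Real.log ((∑ k : Fin n, A i k * Real.exp (-p (Sum.inl k)))
          + Real.exp (-p (Sum.inr ()) - l.2.2)))

/-- The multiplicative form `g^λ` of `f^λ`, for `λ = l = (μ, a, b)`. -/
def gOp {n : ℕ} (A : Matrix (Fin n) (Fin n) ℝ) (l : ℝ × ℝ × ℝ) (y : NodeVec n) : Fin n → ℝ :=
  fun i => (((∑ j : Fin n, A j i * y (Sum.inl j)) + Real.exp l.2.1 * y (Sum.inr ())) /
    ((∑ k : Fin n, A i k * (y (Sum.inl k))⁻¹) + Real.exp (-l.2.2) * (y (Sum.inr ()))⁻¹))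
      ^ (1 / 2 : ℝ)

/-- `F(p) = f^{λ(p)}(p)` as a map of `ℝⁿ`. The temperature of the artificial node has no influence
(`fOp_multipliers_indep` below), and its logarithm is set to `0`. -/
def F {n : ℕ} (A : Matrix (Fin n) (Fin n) ℝ) (α : ℝ) (p : Fin n → ℝ) : Fin n → ℝ :=
  fOp A (multipliers A α (Sum.elim p fun _ => 0)) (Sum.elim p fun _ => 0)

/-- One step `y ↦ g^{λ(log y)}(y)` of the effective HOTS algorithm (artificial node at `1`). -/
def step {n : ℕ} (A : Matrix (Fin n) (Fin n) ℝ) (α : ℝ) (y : Fin n → ℝ) : Fin n → ℝ :=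
  gOp A (multipliers A α fun i => Real.log (Sum.elim y (fun _ => 1) i)) (Sum.elim y fun _ => 1)

/-- The iterates of the effective HOTS algorithm started at `y0`. -/
def iterates {n : ℕ} (A : Matrix (Fin n) (Fin n) ℝ) (α : ℝ) (y0 : Fin n → ℝ) :
    ℕ → Fin n → ℝ :=
  fun k => (step A α)^[k] y0

/-- A HOTS vector: the exponentials of the page coordinates of a minimizer of the dual function. -/
def IsHotsVector {n : ℕ} (A : Matrix (Fin n) (Fin n) ℝ) (α : ℝ) (y : Fin n → ℝ) : Prop :=
  (∀ i, 0 < y i) ∧ ∃ (t : ℝ) (l : ℝ × ℝ × ℝ),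
    ∀ (q : NodeVec n) (l' : ℝ × ℝ × ℝ),
      theta A α (Sum.elim (fun i => Real.log (y i)) fun _ => t) l ≤ theta A α q l'

/-- The Jacobian matrix `∇F(p)`. -/
def jacobianF {n : ℕ} (A : Matrix (Fin n) (Fin n) ℝ) (α : ℝ) (p : Fin n → ℝ) :
    Matrix (Fin n) (Fin n) ℝ :=
  fun k l => fderiv ℝ (F A α) p (Pi.single l 1) k

/-- `|λ₂(M)| = max {|z| : z a complex eigenvalue of M, z ≠ 1}` (and `0` if there is no such `z`). -/
def absLambda2 {n : ℕ} (M : Matrix (Fin n) (Fin n) ℝ) : ℝ :=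
  sSup {r : ℝ | ∃ z ∈ spectrum ℂ (M.map Complex.ofReal), z ≠ 1 ∧ r = ‖z‖}

/-- `u k → v` linearly at rate `r`: `r < 1`, `u` tends to `v`, and
`limsup ‖u k - v‖ ^ (1 / k) ≤ r`. -/
def ConvergesLinearly {n : ℕ} (u : ℕ → Fin n → ℝ) (v : Fin n → ℝ) (r : ℝ) : Prop :=
  r < 1 ∧ Tendsto u atTop (𝓝 v) ∧
    limsup (fun k : ℕ => ENNReal.ofReal (‖u k - v‖ ^ (1 / (k : ℝ)))) atTop ≤ ENNReal.ofReal r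

/-! Well-definedness of `λ(p)` and irrelevance of the artificial node's temperature. -/

/-- The closed form of the minimizer of `θ(p, ·)`. -/
def multipliersFormula {n : ℕ} (A : Matrix (Fin n) (Fin n) ℝ) (α : ℝ) (p : NodeVec n) :
    ℝ × ℝ × ℝ :=
  (Real.log ((2 * α - 1) /
      ∑ i : Fin n, ∑ j : Fin n, A i j * Real.exp (p (Sum.inl i) - p (Sum.inl j))),
   Real.log ((1 - α) / (2 * α - 1) *
      ((∑ i : Fin n, ∑ j : Fin n, A i j * Real.exp (p (Sum.inl i) - p (Sum.inl j))) /
        ∑ j : Fin n, Real.exp (p (Sum.inr ()) - p (Sum.inl j)))),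
   -Real.log ((1 - α) / (2 * α - 1) *
      ((∑ i : Fin n, ∑ j : Fin n, A i j * Real.exp (p (Sum.inl i) - p (Sum.inl j))) /
        ∑ i : Fin n, Real.exp (p (Sum.inl i) - p (Sum.inr ())))))

theorem exp_scalar_lt {c T u : ℝ} (hc : 0 < c) (hT : 0 < T) (hu : u ≠ Real.log (c / T)) :
    c - c * Real.log (c / T) < T * Real.exp u - c * u := by
  have h := Real.add_one_lt_exp (sub_ne_zero.mpr hu)
  rw [Real.exp_sub, Real.exp_log (div_pos hc hT)] at h
  have h2 := mul_lt_mul_of_pos_left h hc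
  have h3 : c * (Real.exp u / (c / T)) = T * Real.exp u := by
    field_simp
  rw [h3] at h2
  linarith

theorem exp_scalar_eq {c T : ℝ} (hc : 0 < c) (hT : 0 < T) :
    T * Real.exp (Real.log (c / T)) - c * Real.log (c / T) = c - c * Real.log (c / T) := by
  rw [Real.exp_log (div_pos hc hT)]
  field_simp

theorem exp_scalar_le {c T : ℝ} (hc : 0 < c) (hT : 0 < T) (u : ℝ) :
    c - c * Real.log (c / T) ≤ T * Real.exp u - c * u := by
  by_cases hu : u = Real.log (c / T)
  · rw [hu, exp_scalar_eq hc hT]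
  · exact (exp_scalar_lt hc hT hu).le

theorem theta_separated {n : ℕ} (A : Matrix (Fin n) (Fin n) ℝ) (α : ℝ) (p : NodeVec n)
    (l : ℝ × ℝ × ℝ) :
    theta A α p l =
      ((∑ i : Fin n, ∑ j : Fin n, A i j * Real.exp (p (Sum.inl i) - p (Sum.inl j)))
          * Real.exp l.1 - (2 * α - 1) * l.1)
      + ((∑ i : Fin n, Real.exp (p (Sum.inl i) - p (Sum.inr ()))) * Real.exp (l.1 - l.2.2)
          - (1 - α) * (l.1 - l.2.2))
      + ((∑ j : Fin n, Real.exp (p (Sum.inr ()) - p (Sum.inl j))) * Real.exp (l.1 + l.2.1)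
          - (1 - α) * (l.1 + l.2.1)) := by
  have e1 : ∀ i : Fin n, Real.exp (-l.2.2 - p (Sum.inr ()) + p (Sum.inl i) + l.1)
      = Real.exp (p (Sum.inl i) - p (Sum.inr ())) * Real.exp (l.1 - l.2.2) := by
    intro i
    rw [← Real.exp_add]
    ring_nf
  have e2 : ∀ i : Fin n, Real.exp (l.2.1 + p (Sum.inr ()) - p (Sum.inl i) + l.1)
      = Real.exp (p (Sum.inr ()) - p (Sum.inl i)) * Real.exp (l.1 + l.2.1) := by
    intro i
    rw [← Real.exp_add]
    ring_nf
  unfold theta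
  simp only [e1, e2, Real.exp_add (_ - _) l.1, ← mul_assoc, ← Finset.sum_mul]
  ring

theorem pairSum_pos {n : ℕ} {A : Matrix (Fin n) (Fin n) ℝ} (hA : ∀ i j, 0 ≤ A i j) (hA0 : A ≠ 0)
    (p : NodeVec n) :
    0 < ∑ i : Fin n, ∑ j : Fin n, A i j * Real.exp (p (Sum.inl i) - p (Sum.inl j)) := by
  have hex : ∃ i j, A i j ≠ 0 := by
    by_contra h
    push Not at h
    exact hA0 (Matrix.ext h)
  obtain ⟨i, j, hij⟩ := hex
  have hnn : ∀ i j, 0 ≤ A i j * Real.exp (p (Sum.inl i) - p (Sum.inl j)) :=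
    fun i j => mul_nonneg (hA i j) (Real.exp_pos _).le
  refine Finset.sum_pos' (fun i _ => Finset.sum_nonneg fun j _ => hnn i j) ⟨i, Finset.mem_univ _, ?_⟩
  exact Finset.sum_pos' (fun j _ => hnn i j) ⟨j, Finset.mem_univ _,
    mul_pos (lt_of_le_of_ne (hA i j) (Ne.symm hij)) (Real.exp_pos _)⟩

theorem nonempty_of_ne_zero {n : ℕ} {A : Matrix (Fin n) (Fin n) ℝ} (hA0 : A ≠ 0) :
    (Finset.univ : Finset (Fin n)).Nonempty := by
  by_contra h
  rw [Finset.not_nonempty_iff_eq_empty] at h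
  exact hA0 (Matrix.ext fun i _ => absurd (Finset.mem_univ i) (by simp [h]))

/-- `multipliersFormula` is the strict global minimizer of `θ(p, ·)`. -/
theorem theta_lt {n : ℕ} {A : Matrix (Fin n) (Fin n) ℝ} (hA : ∀ i j, 0 ≤ A i j) (hA0 : A ≠ 0)
    {α : ℝ} (h1 : 1 / 2 < α) (h2 : α < 1) (p : NodeVec n) {l : ℝ × ℝ × ℝ}
    (hl : l ≠ multipliersFormula A α p) :
    theta A α p (multipliersFormula A α p) < theta A α p l := by
  have hT := pairSum_pos hA hA0 p
  have hX : 0 < ∑ i : Fin n, Real.exp (p (Sum.inl i) - p (Sum.inr ())) :=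
    Finset.sum_pos (fun _ _ => Real.exp_pos _) (nonempty_of_ne_zero hA0)
  have hY : 0 < ∑ j : Fin n, Real.exp (p (Sum.inr ()) - p (Sum.inl j)) :=
    Finset.sum_pos (fun _ _ => Real.exp_pos _) (nonempty_of_ne_zero hA0)
  have hc : 0 < 2 * α - 1 := by linarith
  have hd : 0 < 1 - α := by linarith
  rw [theta_separated, theta_separated]
  unfold multipliersFormula at hl ⊢
  generalize (∑ i : Fin n, ∑ j : Fin n, A i j * Real.exp (p (Sum.inl i) - p (Sum.inl j))) = T at *
  generalize (∑ i : Fin n, Real.exp (p (Sum.inl i) - p (Sum.inr ()))) = X at *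
  generalize (∑ j : Fin n, Real.exp (p (Sum.inr ()) - p (Sum.inl j))) = Y at *
  have k : ∀ Z : ℝ, 0 < Z → Real.log ((2 * α - 1) / T)
      + Real.log ((1 - α) / (2 * α - 1) * (T / Z)) = Real.log ((1 - α) / Z) := by
    intro Z hZ
    rw [← Real.log_mul (by positivity) (by positivity)]
    congr 1
    field_simp
  simp only [sub_neg_eq_add, k X hX, k Y hY]
  rw [exp_scalar_eq hc hT, exp_scalar_eq hd hX, exp_scalar_eq hd hY]
  have b1 := exp_scalar_le hc hT l.1
  have b2 := exp_scalar_le hd hX (l.1 - l.2.2)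
  have b3 := exp_scalar_le hd hY (l.1 + l.2.1)
  by_cases c1 : l.1 = Real.log ((2 * α - 1) / T)
  · by_cases c2 : l.1 - l.2.2 = Real.log ((1 - α) / X)
    · by_cases c3 : l.1 + l.2.1 = Real.log ((1 - α) / Y)
      · exfalso
        apply hl
        have kX := k X hX
        have kY := k Y hY
        refine Prod.ext c1 (Prod.ext ?_ ?_)
        · show l.2.1 = Real.log ((1 - α) / (2 * α - 1) * (T / Y))
          linarith
        · show l.2.2 = -Real.log ((1 - α) / (2 * α - 1) * (T / X))
          linarith
      · linarith [exp_scalar_lt hd hY c3]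
    · linarith [exp_scalar_lt hd hX c2]
  · linarith [exp_scalar_lt hc hT c1]

theorem multipliers_eq {n : ℕ} {A : Matrix (Fin n) (Fin n) ℝ} (hA : ∀ i j, 0 ≤ A i j)
    (hA0 : A ≠ 0) {α : ℝ} (h1 : 1 / 2 < α) (h2 : α < 1) (p : NodeVec n) :
    multipliers A α p = multipliersFormula A α p := by
  have hmin : IsMinOn (theta A α p) Set.univ (multipliersFormula A α p) := by
    intro l _
    by_cases hl : l = multipliersFormula A α p
    · simp [hl]
    · exact (theta_lt hA hA0 h1 h2 p hl).le
  have hs : IsMinOn (theta A α p) Set.univ (multipliers A α p) :=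
    Classical.epsilon_spec (p := fun l => IsMinOn (theta A α p) Set.univ l) ⟨_, hmin⟩
  by_contra hne
  exact absurd (hs (Set.mem_univ (multipliersFormula A α p)))
    (not_le.mpr (theta_lt hA hA0 h1 h2 p hne))

/-- `f^{λ(p)}(p)` does not depend on the coordinate of `p` at the artificial node. -/
theorem fOp_multipliers_indep {n : ℕ} {A : Matrix (Fin n) (Fin n) ℝ} (hA : ∀ i j, 0 ≤ A i j)
    (hA0 : A ≠ 0) {α : ℝ} (h1 : 1 / 2 < α) (h2 : α < 1) (p : Fin n → ℝ) (t : ℝ) :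
    fOp A (multipliers A α (Sum.elim p fun _ => t)) (Sum.elim p fun _ => t) = F A α p := by
  unfold F
  rw [multipliers_eq hA hA0 h1 h2, multipliers_eq hA hA0 h1 h2]
  have hT := pairSum_pos hA hA0 (Sum.elim p fun _ => 0)
  have hX : 0 < ∑ i : Fin n, Real.exp (p i) :=
    Finset.sum_pos (fun _ _ => Real.exp_pos _) (nonempty_of_ne_zero hA0)
  have hY : 0 < ∑ i : Fin n, Real.exp (-p i) :=
    Finset.sum_pos (fun _ _ => Real.exp_pos _) (nonempty_of_ne_zero hA0)
  have hc : 0 < 2 * α - 1 := by linarith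
  have hd : 0 < 1 - α := by linarith
  have ea : ∀ s : ℝ, Real.exp (s + (multipliersFormula A α (Sum.elim p fun _ => s)).2.1)
      = (1 - α) / (2 * α - 1) * ((∑ i : Fin n, ∑ j : Fin n, A i j * Real.exp (p i - p j)) /
          ∑ j : Fin n, Real.exp (-p j)) := by
    intro s
    have hs : ∑ j : Fin n, Real.exp (s - p j) = Real.exp s * ∑ j : Fin n, Real.exp (-p j) := by
      rw [Finset.mul_sum]
      exact Finset.sum_congr rfl fun j _ => by rw [← Real.exp_add, sub_eq_add_neg]
    simp only [Sum.elim_inl] at hT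
    simp only [multipliersFormula, Sum.elim_inl, Sum.elim_inr, hs]
    rw [Real.exp_add, Real.exp_log (by positivity)]
    field_simp
  have eb : ∀ s : ℝ, Real.exp (-s - (multipliersFormula A α (Sum.elim p fun _ => s)).2.2)
      = (1 - α) / (2 * α - 1) * ((∑ i : Fin n, ∑ j : Fin n, A i j * Real.exp (p i - p j)) /
          ∑ j : Fin n, Real.exp (p j)) := by
    intro s
    have hs : ∑ j : Fin n, Real.exp (p j - s) = Real.exp (-s) * ∑ j : Fin n, Real.exp (p j) := by
      rw [Finset.mul_sum]
      exact Finset.sum_congr rfl fun j _ => by rw [← Real.exp_add]; ring_nf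
    simp only [Sum.elim_inl] at hT
    simp only [multipliersFormula, Sum.elim_inl, Sum.elim_inr, hs, sub_neg_eq_add]
    rw [Real.exp_add, Real.exp_log (by positivity)]
    field_simp
  funext i
  simp only [fOp, Sum.elim_inl, Sum.elim_inr, ea, eb]

end Hots

end

noncomputable section

namespace Hots

/-! ### The dual function with the multipliers eliminated, and the closed form of `F`. -/

section FixedPoint

variable {n : ℕ} {A : Matrix (Fin n) (Fin n) ℝ} {α : ℝ}

/-! Minimizing θ over the multipliers leaves, up to a constant, the function `dual` of the page
potentials. It is invariant under adding constants to p, and the HOTS vectors are the exponentials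
of its minimizers.

Minimizers are the fixed points of `F`. On the one hand, F(p) is a diagonal balancing step at p for
the positive matrix A + s, where the uniform entry s depends on p. By the AM-GM inequality such a
step strictly lowers the total weight unless it fixes p (`pairSum_lt_of_balancing`), and log x ≤ x -
1 turns this into strict descent of `dual` (`dual_F_lt`). On the other hand, the flow at a fixed
point is balanced, so the first-order terms in Jensen's inequality for the three logarithms cancel
and the point is a global minimizer; the equality case gives uniqueness up to a constant
(`dual_le_of_fixed`). A minimizer exists because the feasible flow, used as Jensen weights, makes
`dual` coercive modulo constants (`dual_coercive`).

At a fixed point ∇F is self-adjoint for the inner product weighted by the node flows. Twice the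
quadratic form of 1 - ∇F is a sum of three variances, vanishing only on constants, and 1 + ∇F is
positive definite. Hence the spectrum is real and lies in (-1, 1], the eigenvectors for 1 are
constant, and ∇F contracts the weighted complement of the constants by |λ₂| < 1
(`norm_weightedEquiv_fderiv_le`).

Globally, `dual` is a strict Lyapunov function on the quotient by constants, where its sublevel sets
are bounded, so the iterates converge modulo constants. Linearization gives the rate there. Since
`F` commutes with translations, the increments of the iteration are controlled by the error modulo
constants, hence are summable, and the constant component converges at the same rate
(`linear_convergence_of_quotient`). -/

/-- The total weight `∑ A i j * exp (p i - p j)` of the rescaled matrix. -/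
def pairSum (A : Matrix (Fin n) (Fin n) ℝ) (p : Fin n → ℝ) : ℝ :=
  ∑ i, ∑ j, A i j * Real.exp (p i - p j)

/-- The sum of the exponentials of the coordinates. -/
def expSum (p : Fin n → ℝ) : ℝ := ∑ i, Real.exp (p i)

/-- The ratio between the artificial flow and the flow through the web graph. -/
def flowRatio (α : ℝ) : ℝ := (1 - α) / (2 * α - 1)

/-- The numerator of the fixed point operator. -/
def inflow (A : Matrix (Fin n) (Fin n) ℝ) (α : ℝ) (p : Fin n → ℝ) (i : Fin n) : ℝ :=
  ∑ j, A j i * Real.exp (p j) + flowRatio α * (pairSum A p / expSum (-p))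

/-- The denominator of the fixed point operator. -/
def outflow (A : Matrix (Fin n) (Fin n) ℝ) (α : ℝ) (p : Fin n → ℝ) (i : Fin n) : ℝ :=
  ∑ k, A i k * Real.exp (-p k) + flowRatio α * (pairSum A p / expSum p)

/-- The dual function after minimization over the multipliers, up to an additive constant. -/
def dual (A : Matrix (Fin n) (Fin n) ℝ) (α : ℝ) (p : Fin n → ℝ) : ℝ :=
  (2 * α - 1) * Real.log (pairSum A p) + (1 - α) * Real.log (expSum p)
    + (1 - α) * Real.log (expSum (-p))

theorem flowRatio_pos (h1 : 1 / 2 < α) (h2 : α < 1) : 0 < flowRatio α :=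
  div_pos (by linarith) (by linarith)

theorem pairSum_posi (hA : ∀ i j, 0 ≤ A i j) (hA0 : A ≠ 0) (p : Fin n → ℝ) : 0 < pairSum A p :=
  pairSum_pos hA hA0 (Sum.elim p fun _ => 0)

theorem expSum_pos (hA0 : A ≠ 0) (p : Fin n → ℝ) : 0 < expSum p :=
  Finset.sum_pos (fun _ _ => Real.exp_pos _) (nonempty_of_ne_zero hA0)

theorem inflow_pos (hA : ∀ i j, 0 ≤ A i j) (hA0 : A ≠ 0) (h1 : 1 / 2 < α) (h2 : α < 1)
    (p : Fin n → ℝ) (i : Fin n) : 0 < inflow A α p i :=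
  add_pos_of_nonneg_of_pos (Finset.sum_nonneg fun _ _ => mul_nonneg (hA _ _) (Real.exp_pos _).le)
    (mul_pos (flowRatio_pos h1 h2) (div_pos (pairSum_posi hA hA0 p) (expSum_pos hA0 _)))

theorem outflow_pos (hA : ∀ i j, 0 ≤ A i j) (hA0 : A ≠ 0) (h1 : 1 / 2 < α) (h2 : α < 1)
    (p : Fin n → ℝ) (i : Fin n) : 0 < outflow A α p i :=
  add_pos_of_nonneg_of_pos (Finset.sum_nonneg fun _ _ => mul_nonneg (hA _ _) (Real.exp_pos _).le)
    (mul_pos (flowRatio_pos h1 h2) (div_pos (pairSum_posi hA hA0 p) (expSum_pos hA0 _)))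

theorem exp_multipliers_snd_fst (hA : ∀ i j, 0 ≤ A i j) (hA0 : A ≠ 0) (h1 : 1 / 2 < α)
    (h2 : α < 1) (p : Fin n → ℝ) :
    Real.exp (multipliers A α (Sum.elim p fun _ => 0)).2.1
      = flowRatio α * (pairSum A p / expSum (-p)) := by
  have hT := pairSum_posi hA hA0 p
  have hY := expSum_pos hA0 (-p)
  have hk := flowRatio_pos h1 h2
  rw [multipliers_eq hA hA0 h1 h2]
  simp only [multipliersFormula, Sum.elim_inl, Sum.elim_inr, zero_sub]
  exact Real.exp_log (mul_pos hk (div_pos hT hY))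

theorem exp_neg_multipliers_snd_snd (hA : ∀ i j, 0 ≤ A i j) (hA0 : A ≠ 0) (h1 : 1 / 2 < α)
    (h2 : α < 1) (p : Fin n → ℝ) :
    Real.exp (-(multipliers A α (Sum.elim p fun _ => 0)).2.2)
      = flowRatio α * (pairSum A p / expSum p) := by
  have hT := pairSum_posi hA hA0 p
  have hY := expSum_pos hA0 p
  have hk := flowRatio_pos h1 h2
  rw [multipliers_eq hA hA0 h1 h2]
  simp only [multipliersFormula, Sum.elim_inl, Sum.elim_inr, sub_zero, neg_neg]
  exact Real.exp_log (mul_pos hk (div_pos hT hY))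

theorem F_apply (hA : ∀ i j, 0 ≤ A i j) (hA0 : A ≠ 0) (h1 : 1 / 2 < α) (h2 : α < 1)
    (p : Fin n → ℝ) (i : Fin n) :
    F A α p i = 1 / 2 * (Real.log (inflow A α p i) - Real.log (outflow A α p i)) := by
  simp only [F, fOp, Sum.elim_inl, Sum.elim_inr, zero_add, neg_zero, zero_sub,
    exp_multipliers_snd_fst hA hA0 h1 h2, exp_neg_multipliers_snd_snd hA hA0 h1 h2, inflow, outflow]

/-- The logarithm-free form of `F`: a balancing relation, used both for descent and for flow
conservation at fixed points. -/
theorem exp_two_mul_F (hA : ∀ i j, 0 ≤ A i j) (hA0 : A ≠ 0) (h1 : 1 / 2 < α) (h2 : α < 1)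
    (p : Fin n → ℝ) (i : Fin n) :
    Real.exp (2 * F A α p i) * outflow A α p i = inflow A α p i := by
  have hN := inflow_pos hA hA0 h1 h2 p i
  have hD := outflow_pos hA hA0 h1 h2 p i
  rw [F_apply hA hA0 h1 h2, ← mul_assoc, mul_one_div_cancel two_ne_zero, one_mul, Real.exp_sub,
    Real.exp_log hN, Real.exp_log hD, div_mul_cancel₀ _ hD.ne']

theorem step_exp (hA : ∀ i j, 0 ≤ A i j) (hA0 : A ≠ 0) (h1 : 1 / 2 < α) (h2 : α < 1)
    (p : Fin n → ℝ) : step A α (fun i => Real.exp (p i)) = fun i => Real.exp (F A α p i) := by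
  have e : (fun i => Real.log (Sum.elim (fun i => Real.exp (p i)) (fun _ : Unit => (1 : ℝ)) i))
      = Sum.elim p fun _ => 0 := by
    funext i
    cases i <;> simp
  funext i
  have hN := inflow_pos hA hA0 h1 h2 p i
  have hD := outflow_pos hA hA0 h1 h2 p i
  simp only [step, e, gOp, Sum.elim_inl, Sum.elim_inr, mul_one, inv_one, ← Real.exp_neg,
    exp_multipliers_snd_fst hA hA0 h1 h2, exp_neg_multipliers_snd_snd hA hA0 h1 h2]
  change (inflow A α p i / outflow A α p i) ^ (1 / 2 : ℝ) = _
  rw [F_apply hA hA0 h1 h2, Real.rpow_def_of_pos (div_pos hN hD), Real.log_div hN.ne' hD.ne',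
    mul_comm]

theorem iterates_exp (hA : ∀ i j, 0 ≤ A i j) (hA0 : A ≠ 0) (h1 : 1 / 2 < α) (h2 : α < 1)
    (p : Fin n → ℝ) (k : ℕ) :
    iterates A α (fun i => Real.exp (p i)) k = fun i => Real.exp ((F A α)^[k] p i) := by
  induction k with
  | zero => rfl
  | succ k ih =>
    rw [iterates, Function.iterate_succ_apply', Function.iterate_succ_apply', ← iterates, ih,
      step_exp hA hA0 h1 h2]

/-! ### Behaviour under translation by constants. -/

theorem pairSum_add_const (A : Matrix (Fin n) (Fin n) ℝ) (p : Fin n → ℝ) (t : ℝ) :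
    pairSum A (fun i => p i + t) = pairSum A p := by
  simp [pairSum]

theorem expSum_add_const (p : Fin n → ℝ) (t : ℝ) :
    expSum (fun i => p i + t) = Real.exp t * expSum p := by
  simp [expSum, Real.exp_add, Finset.mul_sum, mul_comm]

theorem expSum_neg_add_const (p : Fin n → ℝ) (t : ℝ) :
    expSum (-fun i => p i + t) = Real.exp (-t) * expSum (-p) := by
  rw [← expSum_add_const]
  congr 1
  funext i
  simp
  ring

theorem dual_add_const (hA0 : A ≠ 0) (p : Fin n → ℝ) (t : ℝ) :
    dual A α (fun i => p i + t) = dual A α p := by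
  unfold dual
  rw [pairSum_add_const, expSum_add_const, expSum_neg_add_const,
    Real.log_mul (Real.exp_pos _).ne' (expSum_pos hA0 _).ne',
    Real.log_mul (Real.exp_pos _).ne' (expSum_pos hA0 _).ne', Real.log_exp, Real.log_exp]
  ring

theorem inflow_add_const (A : Matrix (Fin n) (Fin n) ℝ) (α : ℝ) (p : Fin n → ℝ) (t : ℝ)
    (i : Fin n) : inflow A α (fun i => p i + t) i = Real.exp t * inflow A α p i := by
  have h : Real.exp (-t) * Real.exp t = 1 := by rw [← Real.exp_add]; simp
  simp only [inflow, pairSum_add_const, expSum_neg_add_const, Real.exp_add, mul_add,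
    Finset.mul_sum]
  congr 1
  · exact Finset.sum_congr rfl fun j _ => by ring
  · rw [Real.exp_neg]
    field_simp

theorem outflow_add_const (A : Matrix (Fin n) (Fin n) ℝ) (α : ℝ) (p : Fin n → ℝ) (t : ℝ)
    (i : Fin n) : outflow A α (fun i => p i + t) i = Real.exp (-t) * outflow A α p i := by
  simp only [outflow, pairSum_add_const, expSum_add_const, neg_add, Real.exp_add, mul_add,
    Finset.mul_sum]
  congr 1
  · exact Finset.sum_congr rfl fun j _ => by ring
  · rw [Real.exp_neg]
    field_simp

/-- `F` commutes with the addition of constants. -/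
theorem F_add_const (hA : ∀ i j, 0 ≤ A i j) (hA0 : A ≠ 0) (h1 : 1 / 2 < α) (h2 : α < 1)
    (p : Fin n → ℝ) (t : ℝ) : F A α (fun i => p i + t) = fun i => F A α p i + t := by
  funext i
  rw [F_apply hA hA0 h1 h2, F_apply hA hA0 h1 h2, inflow_add_const, outflow_add_const,
    Real.log_mul (Real.exp_pos _).ne' (inflow_pos hA hA0 h1 h2 p i).ne',
    Real.log_mul (Real.exp_pos _).ne' (outflow_pos hA hA0 h1 h2 p i).ne', Real.log_exp,
    Real.log_exp]
  ring

/-! ### HOTS vectors as minimizers of the reduced dual function. -/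

/-- The minimum of `θ(p, ·)` is `dual A α p` up to a constant. -/
theorem theta_multipliersFormula (hA : ∀ i j, 0 ≤ A i j) (hA0 : A ≠ 0) (h1 : 1 / 2 < α)
    (h2 : α < 1) (p : Fin n → ℝ) (t : ℝ) :
    theta A α (Sum.elim p fun _ => t) (multipliersFormula A α (Sum.elim p fun _ => t))
      = dual A α p + ((2 * α - 1) - (2 * α - 1) * Real.log (2 * α - 1)
        + 2 * ((1 - α) - (1 - α) * Real.log (1 - α))) := by
  have hT := pairSum_posi hA hA0 p
  have hX := expSum_pos hA0 p
  have hY := expSum_pos hA0 (-p)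
  have hc : 0 < 2 * α - 1 := by linarith
  have hd : 0 < 1 - α := by linarith
  have eX : ∑ i : Fin n, Real.exp (p i - t) = Real.exp (-t) * expSum p := by
    rw [← expSum_add_const]; rfl
  have eY : ∑ i : Fin n, Real.exp (t - p i) = Real.exp t * expSum (-p) := by
    rw [← expSum_add_const]
    exact Finset.sum_congr rfl fun i _ => by simp [sub_eq_add_neg, add_comm]
  have eT : ∑ i : Fin n, ∑ j : Fin n, A i j * Real.exp (p i - p j) = pairSum A p := rfl
  rw [theta_separated]
  simp only [multipliersFormula, Sum.elim_inl, Sum.elim_inr, eX, eY, eT]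
  have hX' : 0 < Real.exp (-t) * expSum p := by positivity
  have hY' : 0 < Real.exp t * expSum (-p) := by positivity
  have k : ∀ Z : ℝ, 0 < Z → Real.log ((2 * α - 1) / pairSum A p)
      + Real.log ((1 - α) / (2 * α - 1) * (pairSum A p / Z)) = Real.log ((1 - α) / Z) := by
    intro Z hZ
    rw [← Real.log_mul (by positivity) (by positivity)]
    congr 1
    field_simp
  simp only [sub_neg_eq_add, k _ hX', k _ hY']
  rw [exp_scalar_eq hc hT, exp_scalar_eq hd hX', exp_scalar_eq hd hY',
    Real.log_div hc.ne' hT.ne', Real.log_div hd.ne' hX'.ne', Real.log_div hd.ne' hY'.ne',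
    Real.log_mul (Real.exp_pos _).ne' hX.ne', Real.log_mul (Real.exp_pos _).ne' hY.ne',
    Real.log_exp, Real.log_exp]
  unfold dual
  ring

theorem isHotsVector_exp_iff (hA : ∀ i j, 0 ≤ A i j) (hA0 : A ≠ 0) (h1 : 1 / 2 < α)
    (h2 : α < 1) (p : Fin n → ℝ) :
    IsHotsVector A α (fun i => Real.exp (p i)) ↔ ∀ q, dual A α p ≤ dual A α q := by
  have key : ∀ (q : NodeVec n) (l : ℝ × ℝ × ℝ),
      theta A α q (multipliersFormula A α q) ≤ theta A α q l := by
    intro q l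
    by_cases hl : l = multipliersFormula A α q
    · rw [hl]
    · exact (theta_lt hA hA0 h1 h2 q hl).le
  have split : ∀ q : NodeVec n,
      q = Sum.elim (fun i => q (Sum.inl i)) fun _ => q (Sum.inr ()) := by
    intro q
    funext i
    rcases i with i | ⟨⟩ <;> rfl
  simp only [IsHotsVector, Real.log_exp]
  constructor
  · rintro ⟨-, t, l, h⟩ q
    have h3 := (key _ l).trans (h (Sum.elim q fun _ => 0)
      (multipliersFormula A α (Sum.elim q fun _ => 0)))
    rw [theta_multipliersFormula hA hA0 h1 h2, theta_multipliersFormula hA hA0 h1 h2] at h3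
    linarith
  · intro h
    refine ⟨fun i => Real.exp_pos _, 0, multipliersFormula A α (Sum.elim p fun _ => 0), ?_⟩
    intro q l
    refine le_trans ?_ (key q l)
    rw [split q, theta_multipliersFormula hA hA0 h1 h2, theta_multipliersFormula hA hA0 h1 h2]
    linarith [h fun i => q (Sum.inl i)]

/-! ### Strict descent of the dual function along `F`. -/

/-- One balancing step strictly decreases the total weight of a positive matrix. -/
theorem pairSum_lt_of_balancing {B : Matrix (Fin n) (Fin n) ℝ} (hB : ∀ i j, 0 < B i j)
    {p q : Fin n → ℝ}
    (h : ∀ i, Real.exp (2 * q i) * ∑ k, B i k * Real.exp (-p k) = ∑ j, B j i * Real.exp (p j))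
    (hne : q ≠ p) : pairSum B q < pairSum B p := by
  -- The left side is the product of exp(q i - (p i + p j)/2) and exp((p i + p j)/2 - q j); the
  -- right side is the mean of their squares.
  have amgm : ∀ i j, Real.exp (q i - q j) ≤
      (Real.exp (2 * q i) * Real.exp (-p i) * Real.exp (-p j)
        + Real.exp (-(2 * q j)) * Real.exp (p j) * Real.exp (p i)) / 2 := by
    intro i j
    have e1 : Real.exp (2 * q i) * Real.exp (-p i) * Real.exp (-p j)
        = Real.exp (q i - (p i + p j) / 2) ^ 2 := by
      rw [← Real.exp_add, ← Real.exp_add, ← Real.exp_nat_mul]; push_cast; ring_nf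
    have e2 : Real.exp (-(2 * q j)) * Real.exp (p j) * Real.exp (p i)
        = Real.exp ((p i + p j) / 2 - q j) ^ 2 := by
      rw [← Real.exp_add, ← Real.exp_add, ← Real.exp_nat_mul]; push_cast; ring_nf
    have e3 : Real.exp (q i - q j)
        = Real.exp (q i - (p i + p j) / 2) * Real.exp ((p i + p j) / 2 - q j) := by
      rw [← Real.exp_add]; ring_nf
    rw [e1, e2, e3]
    nlinarith [sq_nonneg (Real.exp (q i - (p i + p j) / 2) - Real.exp ((p i + p j) / 2 - q j))]
  obtain ⟨m, hm⟩ : ∃ m, q m ≠ p m := by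
    by_contra! hcon
    exact hne (funext hcon)
  -- On the diagonal the two factors are exp(±(q m - p m)), which differ. Strictness survives in the
  -- sum because the entry B m m is positive.
  have strict : Real.exp (q m - q m) < (Real.exp (2 * q m) * Real.exp (-p m) * Real.exp (-p m)
        + Real.exp (-(2 * q m)) * Real.exp (p m) * Real.exp (p m)) / 2 := by
    have e1 : Real.exp (2 * q m) * Real.exp (-p m) * Real.exp (-p m)
        = Real.exp (2 * (q m - p m)) := by
      rw [← Real.exp_add, ← Real.exp_add]; ring_nf
    have e2 : Real.exp (-(2 * q m)) * Real.exp (p m) * Real.exp (p m)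
        = Real.exp (-(2 * (q m - p m))) := by
      rw [← Real.exp_add, ← Real.exp_add]; ring_nf
    have hx : 2 * (q m - p m) ≠ 0 := mul_ne_zero two_ne_zero (sub_ne_zero.mpr hm)
    rw [e1, e2, sub_self, Real.exp_zero]
    linarith [Real.add_one_lt_exp hx, Real.add_one_lt_exp (neg_ne_zero.mpr hx)]
  -- The balancing relation removes q from each half of the AM-GM bound: by rows here, by columns in
  -- `s2`. Both halves become the weight at p.
  have s1 : ∑ i, ∑ j, B i j * (Real.exp (2 * q i) * Real.exp (-p i) * Real.exp (-p j))
      = pairSum B p := by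
    have e : ∀ i, ∑ j, B i j * (Real.exp (2 * q i) * Real.exp (-p i) * Real.exp (-p j))
        = ∑ j, B j i * Real.exp (p j - p i) := by
      intro i
      have h' := congrArg (fun x => Real.exp (-p i) * x) (h i)
      simp only [Finset.mul_sum] at h'
      calc _ = _ := Finset.sum_congr rfl fun j _ => by ring
        _ = _ := h'
        _ = _ := Finset.sum_congr rfl fun j _ => by
          rw [sub_eq_add_neg, Real.exp_add]; ring
    rw [Finset.sum_congr rfl fun i _ => e i, Finset.sum_comm]
    rfl
  have s2 : ∑ i, ∑ j, B i j * (Real.exp (-(2 * q j)) * Real.exp (p j) * Real.exp (p i))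
      = pairSum B p := by
    have e : ∀ j, ∑ i, B i j * (Real.exp (-(2 * q j)) * Real.exp (p j) * Real.exp (p i))
        = ∑ k, B j k * Real.exp (p j - p k) := by
      intro j
      have h' := congrArg (fun x => Real.exp (-(2 * q j)) * Real.exp (p j) * x) (h j)
      simp only [Finset.mul_sum] at h'
      have h0 : Real.exp (-(2 * q j)) * Real.exp (2 * q j) = 1 := by
        rw [← Real.exp_add]; simp
      calc _ = _ := Finset.sum_congr rfl fun i _ => by ring
        _ = _ := h'.symm
        _ = ∑ k, (Real.exp (-(2 * q j)) * Real.exp (2 * q j)) *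
              (B j k * Real.exp (p j - p k)) := Finset.sum_congr rfl fun k _ => by
            rw [sub_eq_add_neg, Real.exp_add]; ring
        _ = _ := by simp [h0]
    rw [Finset.sum_comm, Finset.sum_congr rfl fun i _ => e i]
    rfl
  have le : ∀ i j, B i j * Real.exp (q i - q j) ≤
      B i j * ((Real.exp (2 * q i) * Real.exp (-p i) * Real.exp (-p j)
        + Real.exp (-(2 * q j)) * Real.exp (p j) * Real.exp (p i)) / 2) :=
    fun i j => mul_le_mul_of_nonneg_left (amgm i j) (hB i j).le
  calc pairSum B q < ∑ i, ∑ j, B i j *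
        ((Real.exp (2 * q i) * Real.exp (-p i) * Real.exp (-p j)
        + Real.exp (-(2 * q j)) * Real.exp (p j) * Real.exp (p i)) / 2) :=
        Finset.sum_lt_sum (fun i _ => Finset.sum_le_sum fun j _ => le i j)
          ⟨m, Finset.mem_univ _, Finset.sum_lt_sum (fun j _ => le m j)
            ⟨m, Finset.mem_univ _, mul_lt_mul_of_pos_left strict (hB m m)⟩⟩
    _ = (∑ i, ∑ j, B i j * (Real.exp (2 * q i) * Real.exp (-p i) * Real.exp (-p j))
        + ∑ i, ∑ j, B i j * (Real.exp (-(2 * q j)) * Real.exp (p j) * Real.exp (p i))) / 2 := by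
        simp only [← Finset.sum_add_distrib, Finset.sum_div]
        exact Finset.sum_congr rfl fun i _ => Finset.sum_congr rfl fun j _ => by ring
    _ = pairSum B p := by rw [s1, s2]; ring

theorem pairSum_const_add (A : Matrix (Fin n) (Fin n) ℝ) (s : ℝ) (p : Fin n → ℝ) :
    pairSum (fun i j => A i j + s) p = pairSum A p + s * (expSum p * expSum (-p)) := by
  have h : expSum p * expSum (-p) = ∑ i, ∑ j, Real.exp (p i - p j) := by
    simp only [expSum, Finset.sum_mul_sum, Pi.neg_apply, ← Real.exp_add, sub_eq_add_neg]
  simp only [h, pairSum, add_mul, Finset.sum_add_distrib, Finset.mul_sum]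

/-- The reduced dual function decreases strictly along the algorithm. -/
theorem dual_F_lt (hA : ∀ i j, 0 ≤ A i j) (hA0 : A ≠ 0) (h1 : 1 / 2 < α) (h2 : α < 1)
    {p : Fin n → ℝ} (hp : F A α p ≠ p) : dual A α (F A α p) < dual A α p := by
  have hT := pairSum_posi hA hA0 p
  have hX := expSum_pos hA0 p
  have hY := expSum_pos hA0 (-p)
  have hk := flowRatio_pos h1 h2
  have hc : 0 < 2 * α - 1 := by linarith
  have hd : 0 < 1 - α := by linarith
  have hkc : flowRatio α * (2 * α - 1) = 1 - α := div_mul_cancel₀ _ hc.ne'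
  -- With this s the artificial terms of inflow and outflow are s · Σ exp(p j) and s · Σ exp(-p k),
  -- so F(p) balances A + s. Here s is frozen at its value for p, also when the weight is evaluated
  -- at F(p).
  obtain ⟨s, hs⟩ : ∃ s, s = flowRatio α * (pairSum A p / (expSum p * expSum (-p))) := ⟨_, rfl⟩
  have hs0 : 0 < s := by rw [hs]; positivity
  have hsX : s * expSum p = flowRatio α * (pairSum A p / expSum (-p)) := by
    rw [hs]; field_simp
  have hsY : s * expSum (-p) = flowRatio α * (pairSum A p / expSum p) := by
    rw [hs]; field_simp
  have key := pairSum_lt_of_balancing (B := fun i j => A i j + s) (p := p) (q := F A α p)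
    (fun i j => add_pos_of_nonneg_of_pos (hA i j) hs0) (by
      intro i
      have h := exp_two_mul_F hA hA0 h1 h2 p i
      rw [outflow, inflow, ← hsX, ← hsY] at h
      simpa only [add_mul, Finset.sum_add_distrib, ← Finset.mul_sum, expSum, Pi.neg_apply]
        using h) hp
  have hT' := pairSum_posi hA hA0 (F A α p)
  have hX' := expSum_pos hA0 (F A α p)
  have hY' := expSum_pos hA0 (-F A α p)
  rw [pairSum_const_add, pairSum_const_add] at key
  unfold dual
  generalize pairSum A (F A α p) = T' at *
  generalize expSum (F A α p) = X' at *
  generalize expSum (-F A α p) = Y' at *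
  generalize pairSum A p = T at *
  generalize expSum p = X at *
  generalize expSum (-p) = Y at *
  -- Each logarithm lies below its tangent at the current point. The weighted sum of the tangents
  -- is, up to scaling by (2α - 1)/T, the change of weight of A + s.
  have l1 := Real.log_le_sub_one_of_pos (div_pos hT' hT)
  have l2 := Real.log_le_sub_one_of_pos (div_pos (mul_pos hX' hY') (mul_pos hX hY))
  rw [Real.log_div hT'.ne' hT.ne'] at l1
  rw [Real.log_div (by positivity) (by positivity), Real.log_mul hX'.ne' hY'.ne',
    Real.log_mul hX.ne' hY.ne'] at l2
  have key' : (2 * α - 1) * (T' / T) + (1 - α) * (X' * Y' / (X * Y))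
      < (2 * α - 1) + (1 - α) := by
    have h := mul_lt_mul_of_pos_left key (div_pos hc hT)
    have ea : (2 * α - 1) / T * (T' + s * (X' * Y'))
        = (2 * α - 1) * (T' / T) + (1 - α) * (X' * Y' / (X * Y)) := by
      rw [hs, ← hkc]; field_simp
    have eb : (2 * α - 1) / T * (T + s * (X * Y)) = (2 * α - 1) + (1 - α) := by
      rw [hs, ← hkc]; field_simp
    rwa [ea, eb] at h
  nlinarith [mul_le_mul_of_nonneg_left l1 hc.le, mul_le_mul_of_nonneg_left l2 hd.le]

/-! ### Jensen's inequality, flow balance and uniqueness. -/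

/-- Jensen's inequality for the logarithm of a sum of exponentials. -/
theorem sum_mul_le_log_sum_exp {ι : Type*} [Fintype ι] {w z : ι → ℝ} (hw : ∀ i, 0 ≤ w i)
    (hW : 0 < ∑ i, w i) :
    ∑ i, w i * z i ≤ (∑ i, w i) *
      (Real.log (∑ i, w i * Real.exp (z i)) - Real.log (∑ i, w i)) := by
  obtain ⟨k, -, hk⟩ := Finset.exists_lt_of_sum_lt (s := Finset.univ) (f := fun _ : ι => (0 : ℝ))
    (g := w) (by simpa using hW)
  have hE : 0 < ∑ i, w i * Real.exp (z i) :=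
    Finset.sum_pos' (fun i _ => mul_nonneg (hw i) (Real.exp_pos _).le)
      ⟨k, Finset.mem_univ _, mul_pos hk (Real.exp_pos _)⟩
  rw [← Real.log_div hE.ne' hW.ne']
  -- Subtracting L normalizes the weighted mean of exp(z i - L) to 1, and then 1 + u ≤ exp u
  -- suffices.
  set L := Real.log ((∑ i, w i * Real.exp (z i)) / ∑ i, w i) with hL
  have hexp : ∑ i, w i * Real.exp (z i - L) = ∑ i, w i := by
    simp only [Real.exp_sub, ← mul_div_assoc, ← Finset.sum_div]
    rw [hL, Real.exp_log (div_pos hE hW)]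
    field_simp
  have hle : ∑ i, w i * (z i - L + 1) ≤ ∑ i, w i * Real.exp (z i - L) :=
    Finset.sum_le_sum fun i _ => mul_le_mul_of_nonneg_left (Real.add_one_le_exp _) (hw i)
  rw [hexp] at hle
  simp only [mul_add, mul_sub, mul_one, Finset.sum_add_distrib, Finset.sum_sub_distrib,
    ← Finset.sum_mul] at hle
  linarith

/-- Equality in `sum_mul_le_log_sum_exp` for positive weights forces constancy. -/
theorem eq_of_log_sum_exp_le {ι : Type*} [Fintype ι] [Nonempty ι] {w z : ι → ℝ}
    (hw : ∀ i, 0 < w i)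
    (h : (∑ i, w i) * (Real.log (∑ i, w i * Real.exp (z i)) - Real.log (∑ i, w i))
      ≤ ∑ i, w i * z i) (m : ι) :
    z m = Real.log (∑ i, w i * Real.exp (z i)) - Real.log (∑ i, w i) := by
  have hW : 0 < ∑ i, w i := Finset.sum_pos (fun i _ => hw i) Finset.univ_nonempty
  have hE : 0 < ∑ i, w i * Real.exp (z i) :=
    Finset.sum_pos (fun i _ => mul_pos (hw i) (Real.exp_pos _)) Finset.univ_nonempty
  rw [← Real.log_div hE.ne' hW.ne'] at h ⊢
  by_contra hm
  set L := Real.log ((∑ i, w i * Real.exp (z i)) / ∑ i, w i) with hL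
  have hexp : ∑ i, w i * Real.exp (z i - L) = ∑ i, w i := by
    simp only [Real.exp_sub, ← mul_div_assoc, ← Finset.sum_div]
    rw [hL, Real.exp_log (div_pos hE hW)]
    field_simp
  have hlt : ∑ i, w i * (z i - L + 1) < ∑ i, w i * Real.exp (z i - L) :=
    Finset.sum_lt_sum
      (fun i _ => mul_le_mul_of_nonneg_left (Real.add_one_le_exp _) (hw i).le)
      ⟨m, Finset.mem_univ _,
        mul_lt_mul_of_pos_left (Real.add_one_lt_exp (sub_ne_zero.mpr hm)) (hw m)⟩
  rw [hexp] at hlt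
  simp only [mul_add, mul_sub, mul_one, Finset.sum_add_distrib, Finset.sum_sub_distrib,
    ← Finset.sum_mul] at hlt
  linarith

/-- The flow along the arcs of the graph determined by the potential `p`. -/
def arcFlow (A : Matrix (Fin n) (Fin n) ℝ) (p : Fin n → ℝ) (i j : Fin n) : ℝ :=
  A i j * Real.exp (p i - p j)

/-- The flow from the artificial node, on the scale of `arcFlow`. -/
def entryFlow (A : Matrix (Fin n) (Fin n) ℝ) (α : ℝ) (p : Fin n → ℝ) (i : Fin n) : ℝ :=
  flowRatio α * (pairSum A p / expSum (-p)) * Real.exp (-p i)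

/-- The flow into the artificial node, on the scale of `arcFlow`. -/
def exitFlow (A : Matrix (Fin n) (Fin n) ℝ) (α : ℝ) (p : Fin n → ℝ) (i : Fin n) : ℝ :=
  flowRatio α * (pairSum A p / expSum p) * Real.exp (p i)

theorem exp_neg_mul_inflow (A : Matrix (Fin n) (Fin n) ℝ) (α : ℝ) (p : Fin n → ℝ) (i : Fin n) :
    Real.exp (-p i) * inflow A α p i = ∑ j, arcFlow A p j i + entryFlow A α p i := by
  rw [inflow, mul_add, Finset.mul_sum, entryFlow, mul_comm (Real.exp (-p i)) (_ * _)]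
  congr 1
  refine Finset.sum_congr rfl fun j _ => ?_
  rw [arcFlow, sub_eq_add_neg, Real.exp_add]
  ring

theorem exp_mul_outflow (A : Matrix (Fin n) (Fin n) ℝ) (α : ℝ) (p : Fin n → ℝ) (i : Fin n) :
    Real.exp (p i) * outflow A α p i = ∑ j, arcFlow A p i j + exitFlow A α p i := by
  rw [outflow, mul_add, Finset.mul_sum, exitFlow, mul_comm (Real.exp (p i)) (_ * _)]
  congr 1
  refine Finset.sum_congr rfl fun j _ => ?_
  rw [arcFlow, sub_eq_add_neg, Real.exp_add]
  ring

/-- At a fixed point of `F` the flow is balanced. -/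
theorem balance_of_fixed (hA : ∀ i j, 0 ≤ A i j) (hA0 : A ≠ 0) (h1 : 1 / 2 < α) (h2 : α < 1)
    {p : Fin n → ℝ} (hp : F A α p = p) (i : Fin n) :
    ∑ j, arcFlow A p i j + exitFlow A α p i = ∑ j, arcFlow A p j i + entryFlow A α p i := by
  have h := exp_two_mul_F hA hA0 h1 h2 p i
  rw [hp] at h
  rw [← exp_neg_mul_inflow, ← exp_mul_outflow, ← h, ← mul_assoc, ← Real.exp_add]
  ring_nf

theorem sum_arcFlow_mul_sub (A : Matrix (Fin n) (Fin n) ℝ) (p x : Fin n → ℝ) :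
    ∑ i, ∑ j, arcFlow A p i j * (x i - x j)
      = ∑ i, (∑ j, arcFlow A p i j - ∑ j, arcFlow A p j i) * x i := by
  simp only [mul_sub, Finset.sum_sub_distrib, sub_mul, Finset.sum_mul]
  congr 1
  exact Finset.sum_comm

/-- Summation by parts together with flow balance: the variation of the arc term is expressed
through the artificial flows alone. This drives both the first-order cancellation in
`dual_le_of_fixed` and the formula for ∇F. -/
theorem sum_arcFlow_mul_sub_of_fixed (hA : ∀ i j, 0 ≤ A i j) (hA0 : A ≠ 0) (h1 : 1 / 2 < α)
    (h2 : α < 1) {p : Fin n → ℝ} (hp : F A α p = p) (x : Fin n → ℝ) :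
    ∑ i, ∑ j, arcFlow A p i j * (x i - x j)
      = ∑ i, entryFlow A α p i * x i - ∑ i, exitFlow A α p i * x i := by
  rw [sum_arcFlow_mul_sub, ← Finset.sum_sub_distrib]
  refine Finset.sum_congr rfl fun i _ => ?_
  linear_combination x i * balance_of_fixed hA hA0 h1 h2 hp i

/-- The tangent inequality at p for the convex function log Σ exp, from Jensen with weights exp(p
i). -/
theorem log_expSum_sub_ge (hA0 : A ≠ 0) (p q : Fin n → ℝ) :
    ∑ i, Real.exp (p i) * (q i - p i)
      ≤ expSum p * (Real.log (expSum q) - Real.log (expSum p)) := by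
  have h := sum_mul_le_log_sum_exp (w := fun i => Real.exp (p i)) (z := fun i => q i - p i)
    (fun i => (Real.exp_pos _).le) (expSum_pos hA0 p)
  have e : ∑ i, Real.exp (p i) * Real.exp (q i - p i) = expSum q := by
    simp only [← Real.exp_add, add_sub_cancel, expSum]
  rwa [e] at h

theorem log_pairSum_sub_ge (hA : ∀ i j, 0 ≤ A i j) (hA0 : A ≠ 0) (p q : Fin n → ℝ) :
    ∑ i, ∑ j, arcFlow A p i j * ((q i - p i) - (q j - p j))
      ≤ pairSum A p * (Real.log (pairSum A q) - Real.log (pairSum A p)) := by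
  have e : ∑ x : Fin n × Fin n, arcFlow A p x.1 x.2 = pairSum A p :=
    Fintype.sum_prod_type _
  have h := sum_mul_le_log_sum_exp (w := fun x : Fin n × Fin n => arcFlow A p x.1 x.2)
    (z := fun x => (q x.1 - p x.1) - (q x.2 - p x.2))
    (fun x => mul_nonneg (hA _ _) (Real.exp_pos _).le) (by rw [e]; exact pairSum_posi hA hA0 p)
  have e2 : ∑ x : Fin n × Fin n, arcFlow A p x.1 x.2
      * Real.exp ((q x.1 - p x.1) - (q x.2 - p x.2)) = pairSum A q := by
    rw [Fintype.sum_prod_type]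
    refine Finset.sum_congr rfl fun i _ => Finset.sum_congr rfl fun j _ => ?_
    simp only [arcFlow]
    rw [mul_assoc, ← Real.exp_add]
    ring_nf
  rw [e, e2, Fintype.sum_prod_type] at h
  exact h

/-- Fixed points of `F` minimize the reduced dual function, and minimizers are unique up to an
additive constant. -/
theorem dual_le_of_fixed (hA : ∀ i j, 0 ≤ A i j) (hA0 : A ≠ 0) (h1 : 1 / 2 < α) (h2 : α < 1)
    {p : Fin n → ℝ} (hp : F A α p = p) (q : Fin n → ℝ) :
    dual A α p ≤ dual A α q ∧
      (dual A α q ≤ dual A α p → ∃ t : ℝ, q = fun i => p i + t) := by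
  have hT := pairSum_posi hA hA0 p
  have hX := expSum_pos hA0 p
  have hY := expSum_pos hA0 (-p)
  have hk := flowRatio_pos h1 h2
  have hc : 0 < 2 * α - 1 := by linarith
  have hkc : flowRatio α * (2 * α - 1) = 1 - α := div_mul_cancel₀ _ hc.ne'
  have jT := log_pairSum_sub_ge hA hA0 p q
  have jX := log_expSum_sub_ge hA0 p q
  have jY := log_expSum_sub_ge hA0 (-p) (-q)
  rw [sum_arcFlow_mul_sub_of_fixed hA hA0 h1 h2 hp fun i => q i - p i] at jT
  have eX : ∑ i, exitFlow A α p i * (q i - p i) = flowRatio α * (pairSum A p / expSum p)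
      * ∑ i, Real.exp (p i) * (q i - p i) := by
    rw [Finset.mul_sum]
    exact Finset.sum_congr rfl fun i _ => by rw [exitFlow]; ring
  have eY : ∑ i, entryFlow A α p i * (q i - p i) = -(flowRatio α * (pairSum A p / expSum (-p))
      * ∑ i, Real.exp ((-p) i) * ((-q) i - (-p) i)) := by
    rw [Finset.mul_sum, ← Finset.sum_neg_distrib]
    exact Finset.sum_congr rfl fun i _ => by simp only [entryFlow, Pi.neg_apply]; ring
  have jX' := mul_le_mul_of_nonneg_left jX (by positivity : 0 ≤ flowRatio α *
    (pairSum A p / expSum p))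
  have jY' := mul_le_mul_of_nonneg_left jY (by positivity : 0 ≤ flowRatio α *
    (pairSum A p / expSum (-p)))
  have rX : flowRatio α * (pairSum A p / expSum p)
      * (expSum p * (Real.log (expSum q) - Real.log (expSum p)))
      = flowRatio α * pairSum A p * (Real.log (expSum q) - Real.log (expSum p)) := by
    field_simp
  have rY : flowRatio α * (pairSum A p / expSum (-p))
      * (expSum (-p) * (Real.log (expSum (-q)) - Real.log (expSum (-p))))
      = flowRatio α * pairSum A p * (Real.log (expSum (-q)) - Real.log (expSum (-p))) := by
    field_simp
  rw [rX] at jX'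
  rw [rY] at jY'
  have ed : (2 * α - 1) * (pairSum A p * (Real.log (pairSum A q) - Real.log (pairSum A p))
      + flowRatio α * pairSum A p * (Real.log (expSum q) - Real.log (expSum p))
      + flowRatio α * pairSum A p * (Real.log (expSum (-q)) - Real.log (expSum (-p))))
      -- The three Jensen right-hand sides add up to a positive multiple of the dual gap, while by
      -- `jT`, `eX` and `eY` the left-hand sides add up to 0.
      = pairSum A p * (dual A α q - dual A α p) := by
    unfold dual
    rw [← hkc]
    ring
  have hnn : 0 ≤ pairSum A p * (dual A α q - dual A α p) := by
    rw [← ed]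
    exact mul_nonneg hc.le (by linarith)
  refine ⟨by linarith [nonneg_of_mul_nonneg_right hnn hT], fun hle => ?_⟩
  have hzero : pairSum A p * (dual A α q - dual A α p) ≤ 0 :=
    mul_nonpos_of_nonneg_of_nonpos hT.le (by linarith)
  rw [← ed] at hzero
  have hzero' := nonpos_of_mul_nonpos_right hzero hc
  -- A zero gap forces equality in every Jensen inequality. The one for `expSum` has strictly
  -- positive weights, so its equality case makes q - p constant.
  have hge : flowRatio α * pairSum A p * (Real.log (expSum q) - Real.log (expSum p))
      ≤ flowRatio α * (pairSum A p / expSum p) * ∑ i, Real.exp (p i) * (q i - p i) := by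
    linarith
  rw [← rX] at hge
  have hge' := le_of_mul_le_mul_left hge (by positivity)
  have : Nonempty (Fin n) := Finset.univ_nonempty_iff.mp (nonempty_of_ne_zero hA0)
  have hex : ∑ i, Real.exp (p i) * Real.exp (q i - p i) = expSum q := by
    simp only [← Real.exp_add, add_sub_cancel, expSum]
  have heq := eq_of_log_sum_exp_le (w := fun i => Real.exp (p i)) (z := fun i => q i - p i)
    (fun i => Real.exp_pos _) (by rw [hex]; exact hge')
  exact ⟨_, funext fun i => sub_eq_iff_eq_add'.mp (heq i)⟩

/-- The reduced dual function is minimal exactly at the fixed points of `F`. -/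
theorem forall_dual_le_iff (hA : ∀ i j, 0 ≤ A i j) (hA0 : A ≠ 0) (h1 : 1 / 2 < α) (h2 : α < 1)
    (p : Fin n → ℝ) : (∀ q, dual A α p ≤ dual A α q) ↔ F A α p = p := by
  refine ⟨fun h => ?_, fun h q => (dual_le_of_fixed hA hA0 h1 h2 h q).1⟩
  by_contra hne
  exact absurd (h (F A α p)) (not_le.mpr (dual_F_lt hA hA0 h1 h2 hne))

theorem fixed_iff_add_const (hA : ∀ i j, 0 ≤ A i j) (hA0 : A ≠ 0) (h1 : 1 / 2 < α) (h2 : α < 1)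
    {p : Fin n → ℝ} (hp : F A α p = p) (q : Fin n → ℝ) :
    F A α q = q ↔ ∃ t : ℝ, q = fun i => p i + t := by
  constructor
  · intro hq
    exact (dual_le_of_fixed hA hA0 h1 h2 hp q).2 (dual_le_of_fixed hA hA0 h1 h2 hq p).1
  · rintro ⟨t, rfl⟩
    rw [F_add_const hA hA0 h1 h2, hp]

/-! ### Coercivity and existence of a fixed point. -/

/-- Without arcs between pages all mass passes through the artificial node, so the total would be
2(1 - α) < 1. -/
theorem ne_zero_of_flow (h1 : 1 / 2 < α) {ρ : Matrix (Fin n ⊕ Unit) (Fin n ⊕ Unit) ℝ}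
    (hρ : IsFeasibleFlow α ρ) (hs : SamePattern ρ (augmented A)) : A ≠ 0 := by
  rintro rfl
  have h0 : ∀ i j : Fin n, ρ (Sum.inl i) (Sum.inl j) = 0 := fun i j => by
    by_contra h
    exact (hs _ _).mp h rfl
  have h00 : ρ (Sum.inr ()) (Sum.inr ()) = 0 := by
    by_contra h
    exact (hs _ _).mp h rfl
  have := hρ.total
  simp only [Fintype.sum_sum_type, h0, Finset.sum_const_zero, zero_add, Finset.univ_unique,
    PUnit.default_eq_unit, Finset.sum_singleton, h00, add_zero, hρ.out_artificial,
    hρ.in_artificial] at this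
  linarith

theorem sum_inner_flow {ρ : Matrix (Fin n ⊕ Unit) (Fin n ⊕ Unit) ℝ}
    (hρ : IsFeasibleFlow α ρ) (hs : SamePattern ρ (augmented A)) :
    ∑ i : Fin n, ∑ j : Fin n, ρ (Sum.inl i) (Sum.inl j) = 2 * α - 1 := by
  have h00 : ρ (Sum.inr ()) (Sum.inr ()) = 0 := by
    by_contra h
    exact (hs _ _).mp h rfl
  have := hρ.total
  simp only [Fintype.sum_sum_type, Finset.univ_unique, Finset.sum_add_distrib,
    PUnit.default_eq_unit, Finset.sum_singleton, h00, add_zero, hρ.out_artificial,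
    hρ.in_artificial] at this
  linarith

theorem le_log_expSum (p : Fin n → ℝ) (i : Fin n) : p i ≤ Real.log (expSum p) := by
  rw [← Real.log_exp (p i)]
  exact Real.log_le_log (Real.exp_pos _)
    (Finset.single_le_sum (f := fun i => Real.exp (p i)) (fun _ _ => (Real.exp_pos _).le)
      (Finset.mem_univ i))

/-- A feasible flow with full support makes the reduced dual function coercive modulo constants. -/
theorem dual_coercive (hA : ∀ i j, 0 ≤ A i j) (h1 : 1 / 2 < α) (h2 : α < 1)
    {ρ : Matrix (Fin n ⊕ Unit) (Fin n ⊕ Unit) ℝ} (hρ : IsFeasibleFlow α ρ)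
    (hs : SamePattern ρ (augmented A)) :
    ∃ ε > 0, ∃ C : ℝ, ∀ p : Fin n → ℝ, ∀ i j, ε * (p i - p j) ≤ dual A α p + C := by
  have hA0 := ne_zero_of_flow h1 hρ hs
  have : Nonempty (Fin n) := Finset.univ_nonempty_iff.mp (nonempty_of_ne_zero hA0)
  have hc : 0 < 2 * α - 1 := by linarith
  have hpos : ∀ i j, augmented A i j ≠ 0 → 0 < ρ i j := fun i j h =>
    lt_of_le_of_ne (hρ.nonneg i j) (Ne.symm ((hs i j).mpr h))
  obtain ⟨m, hm⟩ := Finite.exists_min fun i : Fin n => ρ (Sum.inl i) (Sum.inr ())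
  have hvm : 0 < ρ (Sum.inl m) (Sum.inr ()) := hpos _ _ (one_ne_zero (α := ℝ))
  -- A dominates a multiple of the flow because the flow vanishes off the pattern of A. In the
  -- witness, quotients with A i j = 0 count as 0, and the added 1 keeps the inverse positive.
  obtain ⟨a, ha, hle⟩ : ∃ a > 0, ∀ i j : Fin n, a * ρ (Sum.inl i) (Sum.inl j) ≤ A i j := by
    have hnn : ∀ i j : Fin n, 0 ≤ ρ (Sum.inl i) (Sum.inl j) / A i j := fun i j =>
      div_nonneg (hρ.nonneg _ _) (hA i j)
    have hS : 0 ≤ ∑ i : Fin n, ∑ j : Fin n, ρ (Sum.inl i) (Sum.inl j) / A i j :=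
      Finset.sum_nonneg fun i _ => Finset.sum_nonneg fun j _ => hnn i j
    refine ⟨(1 + ∑ i : Fin n, ∑ j : Fin n, ρ (Sum.inl i) (Sum.inl j) / A i j)⁻¹,
      by positivity, fun i j => ?_⟩
    rcases (hA i j).eq_or_lt with h | h
    · have : ρ (Sum.inl i) (Sum.inl j) = 0 := by
        by_contra h'
        exact (hs _ _).mp h' h.symm
      rw [this, mul_zero, ← h]
    · rw [inv_mul_le_iff₀ (by positivity), ← div_le_iff₀ h]
      have b1 := Finset.single_le_sum (f := fun j => ρ (Sum.inl i) (Sum.inl j) / A i j)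
        (fun j _ => hnn i j) (Finset.mem_univ j)
      have b2 := Finset.single_le_sum
        (f := fun i => ∑ j : Fin n, ρ (Sum.inl i) (Sum.inl j) / A i j)
        (fun i _ => Finset.sum_nonneg fun j _ => hnn i j) (Finset.mem_univ i)
      beta_reduce at b1 b2
      linarith
  -- ε is the smallest flow from a page into the artificial node; the constant collects a and the
  -- total inner weight 2α - 1 from Jensen's inequality.
  refine ⟨_, hvm, -((2 * α - 1) * (Real.log a + Real.log (2 * α - 1))), fun p i j => ?_⟩
  have hT := pairSum_posi hA hA0 p
  have hr := sum_inner_flow hρ hs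
  have hr' : ∑ x : Fin n × Fin n, ρ (Sum.inl x.1) (Sum.inl x.2) = 2 * α - 1 := by
    rw [Fintype.sum_prod_type, hr]
  have jT := sum_mul_le_log_sum_exp (w := fun x : Fin n × Fin n => ρ (Sum.inl x.1) (Sum.inl x.2))
    (z := fun x => p x.1 - p x.2) (fun x => hρ.nonneg _ _) (by rw [hr']; exact hc)
  rw [hr', Fintype.sum_prod_type, Fintype.sum_prod_type] at jT
  set E := ∑ i : Fin n, ∑ j : Fin n, ρ (Sum.inl i) (Sum.inl j) * Real.exp (p i - p j) with hE
  have hE0 : 0 < E := by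
    obtain ⟨k, l, hkl⟩ : ∃ k l, A k l ≠ 0 := by
      by_contra! h
      exact hA0 (Matrix.ext h)
    have hnn : ∀ i j : Fin n, 0 ≤ ρ (Sum.inl i) (Sum.inl j) * Real.exp (p i - p j) :=
      fun i j => mul_nonneg (hρ.nonneg _ _) (Real.exp_pos _).le
    exact Finset.sum_pos' (fun i _ => Finset.sum_nonneg fun j _ => hnn i j)
      ⟨k, Finset.mem_univ _, Finset.sum_pos' (fun j _ => hnn k j) ⟨l, Finset.mem_univ _,
        mul_pos (hpos (Sum.inl k) (Sum.inl l) hkl) (Real.exp_pos _)⟩⟩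
  have hTE : a * E ≤ pairSum A p := by
    simp only [hE, Finset.mul_sum, pairSum, ← mul_assoc]
    exact Finset.sum_le_sum fun i _ => Finset.sum_le_sum fun j _ =>
      mul_le_mul_of_nonneg_right (hle i j) (Real.exp_pos _).le
  have hlog := Real.log_le_log (by positivity) hTE
  rw [Real.log_mul ha.ne' hE0.ne'] at hlog
  have hlog' := mul_le_mul_of_nonneg_left hlog hc.le
  have hbal : ∑ i : Fin n, ∑ j : Fin n, ρ (Sum.inl i) (Sum.inl j) * (p i - p j)
      = ∑ i : Fin n, ρ (Sum.inr ()) (Sum.inl i) * p i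
        - ∑ i : Fin n, ρ (Sum.inl i) (Sum.inr ()) * p i := by
    have e : ∑ i : Fin n, ∑ j : Fin n, ρ (Sum.inl i) (Sum.inl j) * (p i - p j)
        = ∑ i : Fin n, (∑ j : Fin n, ρ (Sum.inl i) (Sum.inl j)
          - ∑ j : Fin n, ρ (Sum.inl j) (Sum.inl i)) * p i := by
      simp only [mul_sub, Finset.sum_sub_distrib, sub_mul, Finset.sum_mul]
      congr 1
      exact Finset.sum_comm
    rw [e, ← Finset.sum_sub_distrib]
    refine Finset.sum_congr rfl fun i _ => ?_
    have hb := hρ.balance (Sum.inl i)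
    simp only [Fintype.sum_sum_type, Finset.univ_unique, PUnit.default_eq_unit,
      Finset.sum_singleton] at hb
    linear_combination p i * hb
  -- The right side is a flow-weighted sum of the slacks log Σ exp(p) - p k ≥ 0. The slack at j is
  -- at least p i - p j, and its weight is at least the minimal one.
  have bX : ρ (Sum.inl m) (Sum.inr ()) * (p i - p j)
      ≤ (1 - α) * Real.log (expSum p) - ∑ i : Fin n, ρ (Sum.inl i) (Sum.inr ()) * p i := by
    rw [← hρ.in_artificial, Finset.sum_mul, ← Finset.sum_sub_distrib]
    have hnn : ∀ k : Fin n, 0 ≤ Real.log (expSum p) - p k :=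
      fun k => sub_nonneg.mpr (le_log_expSum p k)
    have h3 := Finset.single_le_sum (f := fun k : Fin n => ρ (Sum.inl k) (Sum.inr ()) *
      (Real.log (expSum p) - p k)) (fun k _ => mul_nonneg (hρ.nonneg _ _) (hnn k))
      (Finset.mem_univ j)
    simp only [mul_sub] at h3 ⊢
    have h4 := mul_le_mul_of_nonneg_right (hm j) (hnn j)
    have h5 := mul_le_mul_of_nonneg_left (le_log_expSum p i) hvm.le
    beta_reduce at h4
    nlinarith
  have bY : 0 ≤ (1 - α) * Real.log (expSum (-p))
      + ∑ i : Fin n, ρ (Sum.inr ()) (Sum.inl i) * p i := by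
    rw [← hρ.out_artificial, Finset.sum_mul, ← Finset.sum_add_distrib]
    refine Finset.sum_nonneg fun k _ => ?_
    have := le_log_expSum (-p) k
    rw [Pi.neg_apply] at this
    rw [← mul_add]
    exact mul_nonneg (hρ.nonneg _ _) (by linarith)
  unfold dual
  rw [hbal] at jT
  nlinarith

theorem continuous_pairSum (A : Matrix (Fin n) (Fin n) ℝ) : Continuous (pairSum A) := by
  unfold pairSum
  fun_prop

theorem continuous_expSum : Continuous (expSum (n := n)) := by
  unfold expSum
  fun_prop

theorem continuous_dual (hA : ∀ i j, 0 ≤ A i j) (hA0 : A ≠ 0) (α : ℝ) :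
    Continuous (dual A α) := by
  have hY : Continuous fun p : Fin n → ℝ => expSum (-p) := continuous_expSum.comp continuous_neg
  exact ((((continuous_pairSum A).log fun p => (pairSum_posi hA hA0 p).ne').const_mul _).add
    ((continuous_expSum.log fun p => (expSum_pos hA0 p).ne').const_mul _)).add
    ((hY.log fun p => (expSum_pos hA0 _).ne').const_mul _)

/-- The sublevel sets of the reduced dual function have bounded oscillation. -/
theorem exists_sub_le_of_dual_le (hA : ∀ i j, 0 ≤ A i j) (h1 : 1 / 2 < α) (h2 : α < 1)
    (hflow : ∃ ρ : Matrix (Fin n ⊕ Unit) (Fin n ⊕ Unit) ℝ,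
      IsFeasibleFlow α ρ ∧ SamePattern ρ (augmented A)) (b : ℝ) :
    ∃ R : ℝ, ∀ p : Fin n → ℝ, dual A α p ≤ b → ∀ i j, |p i - p j| ≤ R := by
  obtain ⟨ρ, hρ, hs⟩ := hflow
  obtain ⟨ε, hε, C, h⟩ := dual_coercive hA h1 h2 hρ hs
  refine ⟨(b + C) / ε, fun p hp i j => abs_le'.mpr ⟨?_, ?_⟩⟩
  · rw [le_div_iff₀ hε]
    linarith [h p i j]
  · rw [le_div_iff₀ hε]
    linarith [h p j i]

theorem exists_fixed (hA : ∀ i j, 0 ≤ A i j) (h1 : 1 / 2 < α) (h2 : α < 1)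
    (hflow : ∃ ρ : Matrix (Fin n ⊕ Unit) (Fin n ⊕ Unit) ℝ,
      IsFeasibleFlow α ρ ∧ SamePattern ρ (augmented A)) : ∃ p, F A α p = p := by
  have hA0 : A ≠ 0 := by
    obtain ⟨ρ, hρ, hs⟩ := hflow
    exact ne_zero_of_flow h1 hρ hs
  obtain ⟨R, hR⟩ := exists_sub_le_of_dual_le hA h1 h2 hflow (dual A α 0)
  obtain ⟨i0⟩ : Nonempty (Fin n) := Finset.univ_nonempty_iff.mp (nonempty_of_ne_zero hA0)
  have hR0 : 0 ≤ R := by simpa using hR 0 le_rfl i0 i0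
  obtain ⟨p, -, hp⟩ := (isCompact_closedBall (0 : Fin n → ℝ) R).exists_isMinOn
    ⟨0, Metric.mem_closedBall_self hR0⟩ (continuous_dual hA hA0 α).continuousOn
  refine ⟨p, (forall_dual_le_iff hA hA0 h1 h2 p).mp fun q => ?_⟩
  -- Competitors above the level of 0 lose to 0. The others, translated so that coordinate i0
  -- vanishes, lie in the ball of radius R.
  by_cases hq : dual A α q ≤ dual A α 0
  · rw [← dual_add_const hA0 q (-q i0)]
    refine hp ?_
    rw [mem_closedBall_zero_iff, pi_norm_le_iff_of_nonneg hR0]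
    exact fun i => hR q hq i i0
  · exact (hp (Metric.mem_closedBall_self hR0)).trans (not_le.mp hq).le

/-! ### The differential of `F` at a fixed point and its quadratic form. -/

theorem differentiable_F (hA : ∀ i j, 0 ≤ A i j) (hA0 : A ≠ 0) (h1 : 1 / 2 < α) (h2 : α < 1) :
    Differentiable ℝ (F A α) := by
  have hT : Differentiable ℝ (pairSum A) := by
    unfold pairSum
    fun_prop
  have hX : Differentiable ℝ (expSum (n := n)) := by
    unfold expSum
    fun_prop
  have hY : Differentiable ℝ fun p : Fin n → ℝ => expSum (-p) := hX.comp differentiable_id.neg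
  rw [differentiable_pi]
  intro i
  have e : (fun p => F A α p i) = fun p =>
      1 / 2 * (Real.log (inflow A α p i) - Real.log (outflow A α p i)) :=
    funext fun p => F_apply hA hA0 h1 h2 p i
  rw [e]
  have hN : Differentiable ℝ fun p => inflow A α p i := by
    have hq : Differentiable ℝ fun p : Fin n → ℝ => pairSum A p / expSum (-p) := by
      simp only [div_eq_mul_inv]
      exact hT.mul (hY.inv fun p => (expSum_pos hA0 _).ne')
    unfold inflow
    fun_prop
  have hD : Differentiable ℝ fun p => outflow A α p i := by
    have hq : Differentiable ℝ fun p : Fin n → ℝ => pairSum A p / expSum p := by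
      simp only [div_eq_mul_inv]
      exact hT.mul (hX.inv fun p => (expSum_pos hA0 _).ne')
    unfold outflow
    fun_prop
  exact ((hN.log fun p => (inflow_pos hA hA0 h1 h2 p i).ne').sub
    (hD.log fun p => (outflow_pos hA hA0 h1 h2 p i).ne')).const_mul _

/-- The total flow through a page. -/
def nodeFlow (A : Matrix (Fin n) (Fin n) ℝ) (α : ℝ) (p : Fin n → ℝ) (i : Fin n) : ℝ :=
  Real.exp (-p i) * inflow A α p i

theorem nodeFlow_pos (hA : ∀ i j, 0 ≤ A i j) (hA0 : A ≠ 0) (h1 : 1 / 2 < α) (h2 : α < 1)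
    (p : Fin n → ℝ) (i : Fin n) : 0 < nodeFlow A α p i :=
  mul_pos (Real.exp_pos _) (inflow_pos hA hA0 h1 h2 p i)

theorem nodeFlow_eq_of_fixed (hA : ∀ i j, 0 ≤ A i j) (hA0 : A ≠ 0) (h1 : 1 / 2 < α) (h2 : α < 1)
    {p : Fin n → ℝ} (hp : F A α p = p) (i : Fin n) :
    nodeFlow A α p i = Real.exp (p i) * outflow A α p i := by
  rw [nodeFlow, exp_neg_mul_inflow, exp_mul_outflow, balance_of_fixed hA hA0 h1 h2 hp]

theorem hasDerivAt_exp_line (a b : ℝ) :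
    HasDerivAt (fun t : ℝ => Real.exp (a + t * b)) (Real.exp a * b) 0 := by
  have h := (((hasDerivAt_id (0 : ℝ)).mul_const b).const_add a).exp
  simpa using h

theorem hasDerivAt_pairSum (A : Matrix (Fin n) (Fin n) ℝ) (p x : Fin n → ℝ) :
    HasDerivAt (fun t : ℝ => pairSum A (p + t • x))
      (∑ i, ∑ j, arcFlow A p i j * (x i - x j)) 0 := by
  have e : (fun t : ℝ => pairSum A (p + t • x)) = fun t =>
      ∑ i, ∑ j, A i j * Real.exp ((p i - p j) + t * (x i - x j)) := by
    funext t
    refine Finset.sum_congr rfl fun i _ => Finset.sum_congr rfl fun j _ => ?_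
    simp only [Pi.add_apply, Pi.smul_apply, smul_eq_mul]
    ring_nf
  rw [e]
  refine HasDerivAt.fun_sum fun i _ => HasDerivAt.fun_sum fun j _ => ?_
  rw [arcFlow, mul_assoc]
  exact (hasDerivAt_exp_line _ _).const_mul _

theorem hasDerivAt_expSum (p x : Fin n → ℝ) :
    HasDerivAt (fun t : ℝ => expSum (p + t • x)) (∑ i, Real.exp (p i) * x i) 0 :=
  HasDerivAt.fun_sum fun i _ => hasDerivAt_exp_line (p i) (x i)

theorem hasDerivAt_expSum_neg (p x : Fin n → ℝ) :
    HasDerivAt (fun t : ℝ => expSum (-(p + t • x))) (-∑ i, Real.exp (-p i) * x i) 0 := by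
  have h := hasDerivAt_expSum (-p) (-x)
  have e : (fun t : ℝ => expSum (-p + t • -x)) = fun t : ℝ => expSum (-(p + t • x)) := by
    funext t
    rw [smul_neg, neg_add]
  rw [e] at h
  simpa using h

theorem sum_entryFlow_mul (A : Matrix (Fin n) (Fin n) ℝ) (α : ℝ) (p x : Fin n → ℝ) :
    ∑ i, entryFlow A α p i * x i
      = flowRatio α * (pairSum A p / expSum (-p)) * ∑ i, Real.exp (-p i) * x i := by
  rw [Finset.mul_sum]
  exact Finset.sum_congr rfl fun i _ => by rw [entryFlow]; ring

theorem sum_exitFlow_mul (A : Matrix (Fin n) (Fin n) ℝ) (α : ℝ) (p x : Fin n → ℝ) :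
    ∑ i, exitFlow A α p i * x i
      = flowRatio α * (pairSum A p / expSum p) * ∑ i, Real.exp (p i) * x i := by
  rw [Finset.mul_sum]
  exact Finset.sum_congr rfl fun i _ => by rw [exitFlow]; ring

theorem hasDerivAt_inflow (hA : ∀ i j, 0 ≤ A i j) (hA0 : A ≠ 0) (h1 : 1 / 2 < α) (h2 : α < 1)
    {p : Fin n → ℝ} (hp : F A α p = p) (x : Fin n → ℝ) (i : Fin n) :
    HasDerivAt (fun t : ℝ => inflow A α (p + t • x) i)
      (Real.exp (p i) * (∑ j, arcFlow A p j i * x j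
        + entryFlow A α p i * ((∑ j, entryFlow A α p j * x j - ∑ j, exitFlow A α p j * x j)
            / pairSum A p
          + (∑ j, entryFlow A α p j * x j) / (flowRatio α * pairSum A p)))) 0 := by
  have hT := pairSum_posi hA hA0 p
  have hY := expSum_pos hA0 (-p)
  have hk := flowRatio_pos h1 h2
  have hq : HasDerivAt (fun t : ℝ => pairSum A (p + t • x) / expSum (-(p + t • x))) _ 0 :=
    (hasDerivAt_pairSum A p x).fun_div (hasDerivAt_expSum_neg p x) (expSum_pos hA0 _).ne'
  have hs : HasDerivAt (fun t : ℝ => ∑ j, A j i * Real.exp ((p + t • x) j))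
      (∑ j, A j i * (Real.exp (p j) * x j)) 0 :=
    HasDerivAt.fun_sum fun j _ => (hasDerivAt_exp_line (p j) (x j)).const_mul _
  refine (hs.fun_add (hq.const_mul (flowRatio α))).congr_deriv ?_
  rw [sum_arcFlow_mul_sub_of_fixed hA hA0 h1 h2 hp, zero_smul, add_zero]
  have e1 : ∑ j, A j i * (Real.exp (p j) * x j) = Real.exp (p i) * ∑ j, arcFlow A p j i * x j := by
    rw [Finset.mul_sum]
    refine Finset.sum_congr rfl fun j _ => ?_
    rw [arcFlow, Real.exp_sub]
    field_simp
  have e2 : Real.exp (p i) * entryFlow A α p i = flowRatio α * (pairSum A p / expSum (-p)) := by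
    rw [entryFlow, Real.exp_neg]
    field_simp
  rw [e1, mul_add, ← mul_assoc (Real.exp (p i)) (entryFlow A α p i), e2, sum_entryFlow_mul A α p x]
  field_simp
  ring

theorem hasDerivAt_outflow (hA : ∀ i j, 0 ≤ A i j) (hA0 : A ≠ 0) (h1 : 1 / 2 < α) (h2 : α < 1)
    {p : Fin n → ℝ} (hp : F A α p = p) (x : Fin n → ℝ) (i : Fin n) :
    HasDerivAt (fun t : ℝ => outflow A α (p + t • x) i)
      (Real.exp (-p i) * (-∑ j, arcFlow A p i j * x j
        + exitFlow A α p i * ((∑ j, entryFlow A α p j * x j - ∑ j, exitFlow A α p j * x j)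
            / pairSum A p
          - (∑ j, exitFlow A α p j * x j) / (flowRatio α * pairSum A p)))) 0 := by
  have hT := pairSum_posi hA hA0 p
  have hX := expSum_pos hA0 p
  have hk := flowRatio_pos h1 h2
  have hq : HasDerivAt (fun t : ℝ => pairSum A (p + t • x) / expSum (p + t • x)) _ 0 :=
    (hasDerivAt_pairSum A p x).fun_div (hasDerivAt_expSum p x) (expSum_pos hA0 _).ne'
  have hs : HasDerivAt (fun t : ℝ => ∑ j, A i j * Real.exp (-(p + t • x) j))
      (∑ j, A i j * (Real.exp (-p j) * -x j)) 0 := by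
    refine HasDerivAt.fun_sum fun j _ => ?_
    have h := (hasDerivAt_exp_line (-p j) (-x j)).const_mul (A i j)
    have e : (fun t : ℝ => A i j * Real.exp (-p j + t * -x j))
        = fun t : ℝ => A i j * Real.exp (-(p + t • x) j) := by
      funext t
      simp only [Pi.add_apply, Pi.smul_apply, smul_eq_mul]
      ring_nf
    rwa [e] at h
  refine (hs.fun_add (hq.const_mul (flowRatio α))).congr_deriv ?_
  rw [sum_arcFlow_mul_sub_of_fixed hA hA0 h1 h2 hp, zero_smul, add_zero]
  have e1 : ∑ j, A i j * (Real.exp (-p j) * -x j)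
      = Real.exp (-p i) * -∑ j, arcFlow A p i j * x j := by
    rw [← Finset.sum_neg_distrib, Finset.mul_sum]
    refine Finset.sum_congr rfl fun j _ => ?_
    rw [arcFlow, sub_eq_add_neg, Real.exp_add, Real.exp_neg (p i)]
    field_simp
  have e2 : Real.exp (-p i) * exitFlow A α p i = flowRatio α * (pairSum A p / expSum p) := by
    rw [exitFlow, Real.exp_neg]
    field_simp
  rw [e1, mul_add, ← mul_assoc (Real.exp (-p i)) (exitFlow A α p i), e2, sum_exitFlow_mul A α p x]
  field_simp

/-- The differential of `F` at a fixed point. -/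
theorem nodeFlow_mul_fderiv (hA : ∀ i j, 0 ≤ A i j) (hA0 : A ≠ 0) (h1 : 1 / 2 < α) (h2 : α < 1)
    {p : Fin n → ℝ} (hp : F A α p = p) (x : Fin n → ℝ) (i : Fin n) :
    2 * nodeFlow A α p i * fderiv ℝ (F A α) p x i
      = ∑ j, arcFlow A p i j * x j + ∑ j, arcFlow A p j i * x j
        + (entryFlow A α p i - exitFlow A α p i)
          * ((∑ j, entryFlow A α p j * x j - ∑ j, exitFlow A α p j * x j) / pairSum A p)
        + entryFlow A α p i * ((∑ j, entryFlow A α p j * x j) / (flowRatio α * pairSum A p))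
        + exitFlow A α p i * ((∑ j, exitFlow A α p j * x j) / (flowRatio α * pairSum A p)) := by
  have hline : HasDerivAt (fun t : ℝ => p + t • x) x 0 := by
    simpa using ((hasDerivAt_id (0 : ℝ)).smul_const x).const_add p
  have hF : HasFDerivAt (F A α) (fderiv ℝ (F A α) p) (p + (0 : ℝ) • x) := by
    rw [zero_smul, add_zero]
    exact (differentiable_F hA hA0 h1 h2 p).hasFDerivAt
  have d1 := (hasDerivAt_pi.mp (hF.comp_hasDerivAt 0 hline)) i
  have hN := inflow_pos hA hA0 h1 h2 p i
  have hD := outflow_pos hA hA0 h1 h2 p i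
  have hN0 : inflow A α (p + (0 : ℝ) • x) i ≠ 0 := (inflow_pos hA hA0 h1 h2 _ i).ne'
  have hD0 : outflow A α (p + (0 : ℝ) • x) i ≠ 0 := (outflow_pos hA hA0 h1 h2 _ i).ne'
  have d2 := (((hasDerivAt_inflow hA hA0 h1 h2 hp x i).log hN0).fun_sub
    ((hasDerivAt_outflow hA hA0 h1 h2 hp x i).log hD0)).const_mul (1 / 2 : ℝ)
  have e : (fun t : ℝ => (F A α ∘ fun t : ℝ => p + t • x) t i) = fun t : ℝ =>
      1 / 2 * (Real.log (inflow A α (p + t • x) i) - Real.log (outflow A α (p + t • x) i)) :=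
    funext fun t => F_apply hA hA0 h1 h2 _ i
  rw [e] at d1
  rw [d1.unique d2, zero_smul, add_zero]
  -- At a fixed point the node flow is the rescaled inflow and also the rescaled outflow, so
  -- multiplying by it clears both logarithmic derivatives.
  have e1 : ∀ z, nodeFlow A α p i * (Real.exp (p i) * z / inflow A α p i) = z := by
    intro z
    rw [nodeFlow, Real.exp_neg]
    field_simp
  have e2 : ∀ z, nodeFlow A α p i * (Real.exp (-p i) * z / outflow A α p i) = z := by
    intro z
    rw [nodeFlow_eq_of_fixed hA hA0 h1 h2 hp, Real.exp_neg]
    field_simp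
  have e3 : ∀ a b : ℝ, 2 * nodeFlow A α p i * (1 / 2 * (a - b))
      = nodeFlow A α p i * a - nodeFlow A α p i * b := fun a b => by ring
  rw [e3, e1, e2]
  ring

/-- The bilinear form of the differential of `F` at a fixed point. -/
theorem sum_nodeFlow_mul_fderiv (hA : ∀ i j, 0 ≤ A i j) (hA0 : A ≠ 0) (h1 : 1 / 2 < α)
    (h2 : α < 1) {p : Fin n → ℝ} (hp : F A α p = p) (x y : Fin n → ℝ) :
    2 * ∑ i, nodeFlow A α p i * (y i * fderiv ℝ (F A α) p x i)
      = ∑ i, ∑ j, arcFlow A p i j * (y i * x j + y j * x i)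
        + (∑ j, entryFlow A α p j * y j - ∑ j, exitFlow A α p j * y j)
          * ((∑ j, entryFlow A α p j * x j - ∑ j, exitFlow A α p j * x j) / pairSum A p)
        + (∑ j, entryFlow A α p j * y j)
          * ((∑ j, entryFlow A α p j * x j) / (flowRatio α * pairSum A p))
        + (∑ j, exitFlow A α p j * y j)
          * ((∑ j, exitFlow A α p j * x j) / (flowRatio α * pairSum A p)) := by
  have e : ∑ i, ∑ j, arcFlow A p i j * (y i * x j + y j * x i)
      = ∑ i, y i * (∑ j, arcFlow A p i j * x j + ∑ j, arcFlow A p j i * x j) := by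
    simp only [mul_add, Finset.sum_add_distrib, Finset.mul_sum]
    congr 1
    · exact Finset.sum_congr rfl fun i _ => Finset.sum_congr rfl fun j _ => by ring
    · rw [Finset.sum_comm]
      exact Finset.sum_congr rfl fun i _ => Finset.sum_congr rfl fun j _ => by ring
  rw [e, ← Finset.sum_sub_distrib, Finset.mul_sum, Finset.sum_mul, Finset.sum_mul, Finset.sum_mul,
    ← Finset.sum_add_distrib, ← Finset.sum_add_distrib, ← Finset.sum_add_distrib]
  refine Finset.sum_congr rfl fun i _ => ?_
  linear_combination y i * nodeFlow_mul_fderiv hA hA0 h1 h2 hp x i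

theorem sum_nodeFlow_mul_fderiv_comm (hA : ∀ i j, 0 ≤ A i j) (hA0 : A ≠ 0) (h1 : 1 / 2 < α)
    (h2 : α < 1) {p : Fin n → ℝ} (hp : F A α p = p) (x y : Fin n → ℝ) :
    ∑ i, nodeFlow A α p i * (y i * fderiv ℝ (F A α) p x i)
      = ∑ i, nodeFlow A α p i * (x i * fderiv ℝ (F A α) p y i) := by
  have hx := sum_nodeFlow_mul_fderiv hA hA0 h1 h2 hp x y
  have hy := sum_nodeFlow_mul_fderiv hA hA0 h1 h2 hp y x
  have e : ∑ i, ∑ j, arcFlow A p i j * (y i * x j + y j * x i)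
      = ∑ i, ∑ j, arcFlow A p i j * (x i * y j + x j * y i) :=
    Finset.sum_congr rfl fun i _ => Finset.sum_congr rfl fun j _ => by ring
  rw [e] at hx
  refine mul_left_cancel₀ (two_ne_zero (α := ℝ)) ?_
  rw [hx, hy]
  ring

/-- Twice the node flow is inflow plus outflow. This puts the weighted norm in the same arc-by-arc
shape as the bilinear form of ∇F, so that the two can be compared. -/
theorem two_mul_sum_nodeFlow_mul_sq (hA : ∀ i j, 0 ≤ A i j) (hA0 : A ≠ 0) (h1 : 1 / 2 < α)
    (h2 : α < 1) {p : Fin n → ℝ} (hp : F A α p = p) (x : Fin n → ℝ) :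
    2 * ∑ i, nodeFlow A α p i * x i ^ 2
      = ∑ i, ∑ j, arcFlow A p i j * (x i ^ 2 + x j ^ 2)
        + ∑ i, entryFlow A α p i * x i ^ 2 + ∑ i, exitFlow A α p i * x i ^ 2 := by
  have e : ∑ i, ∑ j, arcFlow A p i j * (x i ^ 2 + x j ^ 2)
      = ∑ i, (∑ j, arcFlow A p i j + ∑ j, arcFlow A p j i) * x i ^ 2 := by
    simp only [mul_add, add_mul, Finset.sum_add_distrib, Finset.sum_mul]
    congr 1
    exact Finset.sum_comm
  rw [e, Finset.mul_sum, ← Finset.sum_add_distrib, ← Finset.sum_add_distrib]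
  refine Finset.sum_congr rfl fun i _ => ?_
  have hb := balance_of_fixed hA hA0 h1 h2 hp i
  rw [nodeFlow, exp_neg_mul_inflow]
  linear_combination -(x i ^ 2) * hb

/-- The weighted variance identity. -/
theorem sum_mul_sq_sub_mean {ι : Type*} [Fintype ι] (w z : ι → ℝ) (hW : ∑ i, w i ≠ 0) :
    ∑ i, w i * (z i - (∑ i, w i * z i) / ∑ i, w i) ^ 2
      = ∑ i, w i * z i ^ 2 - (∑ i, w i * z i) * ((∑ i, w i * z i) / ∑ i, w i) := by
  set μ := (∑ i, w i * z i) / ∑ i, w i with hμ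
  have h : (∑ i, w i) * μ = ∑ i, w i * z i := mul_div_cancel₀ _ hW
  have e : ∑ i, w i * (z i - μ) ^ 2
      = ∑ i, w i * z i ^ 2 - 2 * μ * ∑ i, w i * z i + μ ^ 2 * ∑ i, w i := by
    rw [Finset.mul_sum, Finset.mul_sum, ← Finset.sum_sub_distrib, ← Finset.sum_add_distrib]
    exact Finset.sum_congr rfl fun i _ => by ring
  rw [e]
  linear_combination μ * h

theorem entryFlow_pos (hA : ∀ i j, 0 ≤ A i j) (hA0 : A ≠ 0) (h1 : 1 / 2 < α) (h2 : α < 1)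
    (p : Fin n → ℝ) (i : Fin n) : 0 < entryFlow A α p i :=
  mul_pos (mul_pos (flowRatio_pos h1 h2) (div_pos (pairSum_posi hA hA0 p) (expSum_pos hA0 _)))
    (Real.exp_pos _)

theorem exitFlow_pos (hA : ∀ i j, 0 ≤ A i j) (hA0 : A ≠ 0) (h1 : 1 / 2 < α) (h2 : α < 1)
    (p : Fin n → ℝ) (i : Fin n) : 0 < exitFlow A α p i :=
  mul_pos (mul_pos (flowRatio_pos h1 h2) (div_pos (pairSum_posi hA hA0 p) (expSum_pos hA0 _)))
    (Real.exp_pos _)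

theorem arcFlow_nonneg (hA : ∀ i j, 0 ≤ A i j) (p : Fin n → ℝ) (i j : Fin n) :
    0 ≤ arcFlow A p i j :=
  mul_nonneg (hA _ _) (Real.exp_pos _).le

theorem sum_entryFlow (hA0 : A ≠ 0) (α : ℝ) (p : Fin n → ℝ) :
    ∑ i, entryFlow A α p i = flowRatio α * pairSum A p := by
  have h := sum_entryFlow_mul A α p fun _ => 1
  have hY := expSum_pos hA0 (-p)
  simp only [mul_one] at h
  rw [h]
  change _ * expSum (-p) = _
  field_simp

theorem sum_exitFlow (hA0 : A ≠ 0) (α : ℝ) (p : Fin n → ℝ) :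
    ∑ i, exitFlow A α p i = flowRatio α * pairSum A p := by
  have h := sum_exitFlow_mul A α p fun _ => 1
  have hY := expSum_pos hA0 p
  simp only [mul_one] at h
  rw [h]
  change _ * expSum p = _
  field_simp

/-- `∇F(p) ≤ 1` at a fixed point, for the inner product weighted by the node flows; equality only on
the constants. -/
theorem sum_nodeFlow_mul_fderiv_le (hA : ∀ i j, 0 ≤ A i j) (hA0 : A ≠ 0) (h1 : 1 / 2 < α)
    (h2 : α < 1) {p : Fin n → ℝ} (hp : F A α p = p) (x : Fin n → ℝ) :
    ∑ i, nodeFlow A α p i * (x i * fderiv ℝ (F A α) p x i) ≤ ∑ i, nodeFlow A α p i * x i ^ 2 ∧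
      (∑ i, nodeFlow A α p i * x i ^ 2
          ≤ ∑ i, nodeFlow A α p i * (x i * fderiv ℝ (F A α) p x i) →
        ∃ t : ℝ, ∀ i, x i = t) := by
  have hT := pairSum_posi hA hA0 p
  have hk := flowRatio_pos h1 h2
  have hkT := mul_pos hk hT
  have b1 := sum_nodeFlow_mul_fderiv hA hA0 h1 h2 hp x x
  have b2 := two_mul_sum_nodeFlow_mul_sq hA hA0 h1 h2 hp x
  have eT : ∑ i, ∑ j, arcFlow A p i j = pairSum A p := rfl
  -- Twice the gap between the two forms is the sum of three unnormalized variances: of x i - x j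
  -- under the arc flow, and of x under the entry and the exit flow. The entry weights are all
  -- positive, so a zero gap makes x constant.
  have vT := sum_mul_sq_sub_mean (fun y : Fin n × Fin n => arcFlow A p y.1 y.2)
    (fun y => x y.1 - x y.2) (by rw [Fintype.sum_prod_type, eT]; exact hT.ne')
  have vu := sum_mul_sq_sub_mean (entryFlow A α p) x (by rw [sum_entryFlow hA0]; exact hkT.ne')
  have vv := sum_mul_sq_sub_mean (exitFlow A α p) x (by rw [sum_exitFlow hA0]; exact hkT.ne')
  simp only [Fintype.sum_prod_type, eT, sum_arcFlow_mul_sub_of_fixed hA hA0 h1 h2 hp] at vT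
  rw [sum_entryFlow hA0] at vu
  rw [sum_exitFlow hA0] at vv
  have nT : 0 ≤ ∑ i, ∑ j, arcFlow A p i j * (x i - x j - (∑ i, entryFlow A α p i * x i
      - ∑ i, exitFlow A α p i * x i) / pairSum A p) ^ 2 :=
    Finset.sum_nonneg fun i _ => Finset.sum_nonneg fun j _ =>
      mul_nonneg (arcFlow_nonneg hA p i j) (sq_nonneg _)
  have nu : ∀ i ∈ Finset.univ, 0 ≤ entryFlow A α p i * (x i - (∑ i, entryFlow A α p i * x i)
      / (flowRatio α * pairSum A p)) ^ 2 := fun i _ =>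
    mul_nonneg (entryFlow_pos hA hA0 h1 h2 p i).le (sq_nonneg _)
  have nv : ∀ i ∈ Finset.univ, 0 ≤ exitFlow A α p i * (x i - (∑ i, exitFlow A α p i * x i)
      / (flowRatio α * pairSum A p)) ^ 2 := fun i _ =>
    mul_nonneg (exitFlow_pos hA hA0 h1 h2 p i).le (sq_nonneg _)
  have e : ∑ i, ∑ j, arcFlow A p i j * (x i - x j) ^ 2
      = ∑ i, ∑ j, arcFlow A p i j * (x i ^ 2 + x j ^ 2)
        - ∑ i, ∑ j, arcFlow A p i j * (x i * x j + x j * x i) := by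
    simp only [← Finset.sum_sub_distrib]
    exact Finset.sum_congr rfl fun i _ => Finset.sum_congr rfl fun j _ => by ring
  rw [e] at vT
  have su := Finset.sum_nonneg nu
  have sv := Finset.sum_nonneg nv
  refine ⟨by linarith, fun hle => ?_⟩
  have hu0 : ∑ i, entryFlow A α p i * (x i - (∑ i, entryFlow A α p i * x i)
      / (flowRatio α * pairSum A p)) ^ 2 = 0 := le_antisymm (by linarith) su
  rw [Finset.sum_eq_zero_iff_of_nonneg nu] at hu0
  refine ⟨_, fun i => sub_eq_zero.mp (pow_eq_zero_iff two_ne_zero |>.mp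
    ((mul_eq_zero.mp (hu0 i (Finset.mem_univ i))).resolve_left
      (entryFlow_pos hA hA0 h1 h2 p i).ne'))⟩

/-- `-1 < ∇F(p)` at a fixed point, for the inner product weighted by the node flows. -/
theorem neg_lt_sum_nodeFlow_mul_fderiv (hA : ∀ i j, 0 ≤ A i j) (hA0 : A ≠ 0) (h1 : 1 / 2 < α)
    (h2 : α < 1) {p : Fin n → ℝ} (hp : F A α p = p) {x : Fin n → ℝ} (hx : x ≠ 0) :
    -∑ i, nodeFlow A α p i * x i ^ 2
      < ∑ i, nodeFlow A α p i * (x i * fderiv ℝ (F A α) p x i) := by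
  have hT := pairSum_posi hA hA0 p
  have hkT := mul_pos (flowRatio_pos h1 h2) hT
  have b1 := sum_nodeFlow_mul_fderiv hA hA0 h1 h2 hp x x
  have b2 := two_mul_sum_nodeFlow_mul_sq hA hA0 h1 h2 hp x
  obtain ⟨m, hm⟩ := Function.ne_iff.mp hx
  have pu : 0 < ∑ i, entryFlow A α p i * x i ^ 2 :=
    Finset.sum_pos' (fun i _ => mul_nonneg (entryFlow_pos hA hA0 h1 h2 p i).le (sq_nonneg _))
      ⟨m, Finset.mem_univ _, mul_pos (entryFlow_pos hA hA0 h1 h2 p m) (sq_pos_of_ne_zero hm)⟩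
  have pv : 0 ≤ ∑ i, exitFlow A α p i * x i ^ 2 :=
    Finset.sum_nonneg fun i _ => mul_nonneg (exitFlow_pos hA hA0 h1 h2 p i).le (sq_nonneg _)
  -- Adding the forms turns the arc part into squares of x i + x j. The rank-one terms are squares
  -- too, and the entry term is strictly positive.
  have nT : 0 ≤ ∑ i, ∑ j, arcFlow A p i j * (x i + x j) ^ 2 :=
    Finset.sum_nonneg fun i _ => Finset.sum_nonneg fun j _ =>
      mul_nonneg (arcFlow_nonneg hA p i j) (sq_nonneg _)
  have e : ∑ i, ∑ j, arcFlow A p i j * (x i + x j) ^ 2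
      = ∑ i, ∑ j, arcFlow A p i j * (x i ^ 2 + x j ^ 2)
        + ∑ i, ∑ j, arcFlow A p i j * (x i * x j + x j * x i) := by
    simp only [← Finset.sum_add_distrib]
    exact Finset.sum_congr rfl fun i _ => Finset.sum_congr rfl fun j _ => by ring
  rw [e] at nT
  have q : ∀ a b : ℝ, 0 < b → 0 ≤ a * (a / b) := fun a b hb => by
    rw [← mul_div_assoc]
    exact div_nonneg (mul_self_nonneg a) hb.le
  have q1 := q (∑ j, entryFlow A α p j * x j - ∑ j, exitFlow A α p j * x j) _ hT
  have q2 := q (∑ j, entryFlow A α p j * x j) _ hkT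
  have q3 := q (∑ j, exitFlow A α p j * x j) _ hkT
  linarith

end FixedPoint

/-! ### Spectral theory for a weighted inner product. -/

/-- The coordinates scaled by the square roots of positive weights, as a linear equivalence with
Euclidean space. -/
def weightedEquiv {n : ℕ} (m : Fin n → ℝ) (hm : ∀ i, 0 < m i) :
    (Fin n → ℝ) ≃L[ℝ] EuclideanSpace ℝ (Fin n) :=
  LinearEquiv.toContinuousLinearEquiv
    { toFun := fun x => WithLp.toLp 2 fun i => √(m i) * x i
      invFun := fun x i => x i / √(m i)
      map_add' := fun x y => by
        ext i
        simp [mul_add]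
      map_smul' := fun c x => by
        ext i
        simp [mul_left_comm]
      left_inv := fun x => by
        funext i
        exact mul_div_cancel_left₀ _ (Real.sqrt_pos.mpr (hm i)).ne'
      right_inv := fun x => by
        ext i
        exact mul_div_cancel₀ _ (Real.sqrt_pos.mpr (hm i)).ne' }

theorem weightedEquiv_apply {n : ℕ} (m : Fin n → ℝ) (hm : ∀ i, 0 < m i) (x : Fin n → ℝ)
    (i : Fin n) : weightedEquiv m hm x i = √(m i) * x i := rfl

theorem inner_weightedEquiv {n : ℕ} (m : Fin n → ℝ) (hm : ∀ i, 0 < m i) (x y : Fin n → ℝ) :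
    inner ℝ (weightedEquiv m hm x) (weightedEquiv m hm y) = ∑ i, m i * (x i * y i) := by
  rw [EuclideanSpace.inner_eq_star_dotProduct]
  refine Finset.sum_congr rfl fun i _ => ?_
  simp only [Pi.star_apply, star_trivial, weightedEquiv_apply]
  linear_combination x i * y i * Real.mul_self_sqrt (hm i).le

/-- A map that is symmetric for a weighted inner product contracts the orthogonal complement of the
constants by the largest modulus of its eigenvalues other than `1`, if the eigenvectors for `1`
are constant. -/
theorem norm_weightedEquiv_apply_le {n : ℕ} {m : Fin n → ℝ} (hm : ∀ i, 0 < m i)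
    (L : (Fin n → ℝ) →ₗ[ℝ] (Fin n → ℝ))
    (hsym : ∀ x y, ∑ i, m i * (y i * L x i) = ∑ i, m i * (x i * L y i))
    (hone : ∀ x, L x = x → ∃ t : ℝ, ∀ i, x i = t) {r : ℝ} (hr : 0 ≤ r)
    (hle : ∀ (s : ℝ) (x : Fin n → ℝ), x ≠ 0 → L x = s • x → s ≠ 1 → |s| ≤ r)
    {x : Fin n → ℝ} (hx : ∑ i, m i * x i = 0) :
    ‖weightedEquiv m hm (L x)‖ ≤ r * ‖weightedEquiv m hm x‖ := by
  have hs : ∀ i, √(m i) ≠ 0 := fun i => (Real.sqrt_pos.mpr (hm i)).ne'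
  -- Conjugation by the square roots of the weights makes L an ordinary symmetric matrix with the
  -- same eigenvalues; its orthonormal eigenbasis allows a comparison coordinate by coordinate.
  set K : Matrix (Fin n) (Fin n) ℝ := Matrix.of fun i j => √(m i) * L.toMatrix' i j / √(m j)
    with hK
  have hKL : ∀ y : Fin n → ℝ, K.mulVec (fun i => √(m i) * y i) = fun i => √(m i) * L y i := by
    intro y
    funext i
    rw [← LinearMap.toMatrix'_mulVec L y]
    simp only [Matrix.mulVec, dotProduct, hK, Matrix.of_apply, Finset.mul_sum]
    refine Finset.sum_congr rfl fun j _ => ?_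
    have := hs j
    field_simp
  have hH : K.IsHermitian := by
    refine Matrix.IsHermitian.ext fun i j => ?_
    have h := hsym (Pi.single i 1) (Pi.single j 1)
    simp only [Pi.single_apply, ite_mul, one_mul, zero_mul, mul_ite, mul_zero,
      Finset.sum_ite_eq', Finset.mem_univ, if_true] at h
    simp only [hK, Matrix.of_apply, LinearMap.toMatrix'_apply, star_trivial]
    rw [div_eq_div_iff (hs i) (hs j)]
    linear_combination h + (L (Pi.single i 1) j) * Real.mul_self_sqrt (hm j).le
      - (L (Pi.single j 1) i) * Real.mul_self_sqrt (hm i).le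
  set b := hH.eigenvectorBasis
  have key : ∀ k, inner ℝ (b k) (weightedEquiv m hm (L x)) ^ 2
      ≤ r ^ 2 * inner ℝ (b k) (weightedEquiv m hm x) ^ 2 := by
    intro k
    obtain ⟨f, hf⟩ := (weightedEquiv m hm).surjective (b k)
    have hf0 : f ≠ 0 := by
      rintro rfl
      rw [map_zero] at hf
      exact b.orthonormal.ne_zero k hf.symm
    have hLf : L f = hH.eigenvalues k • f := by
      have h := hH.mulVec_eigenvectorBasis k
      have hbk : (b k).ofLp = fun i => √(m i) * f i := by rw [← hf]; rfl
      change K.mulVec (b k).ofLp = hH.eigenvalues k • (b k).ofLp at h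
      rw [hbk, hKL] at h
      funext i
      have hi := congrFun h i
      simp only [Pi.smul_apply, smul_eq_mul] at hi ⊢
      exact mul_left_cancel₀ (hs i) (by linear_combination hi)
    rw [← hf, inner_weightedEquiv, inner_weightedEquiv, hsym, hLf]
    have e : ∑ i, m i * (x i * (hH.eigenvalues k • f) i)
        = hH.eigenvalues k * ∑ i, m i * (f i * x i) := by
      rw [Finset.mul_sum]
      refine Finset.sum_congr rfl fun i _ => ?_
      simp only [Pi.smul_apply, smul_eq_mul]
      ring
    rw [e, mul_pow]
    by_cases h1 : hH.eigenvalues k = 1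
    · rw [h1, one_smul] at hLf
      obtain ⟨t, ht⟩ := hone f hLf
      -- For the eigenvalue 1 the eigenvector is constant, so the weighted mean zero condition on x
      -- kills this coordinate.
      have h0 : ∑ i, m i * (f i * x i) = 0 := by
        rw [← mul_zero t, ← hx, Finset.mul_sum]
        exact Finset.sum_congr rfl fun i _ => by rw [ht]; ring
      simp [h0]
    · exact mul_le_mul_of_nonneg_right
        (sq_le_sq' (abs_le.mp (hle _ f hf0 hLf h1)).1 (abs_le.mp (hle _ f hf0 hLf h1)).2)
        (sq_nonneg _)
  refine le_of_sq_le_sq ?_ (by positivity)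
  rw [mul_pow, ← b.sum_sq_inner_right, ← b.sum_sq_inner_right, Finset.mul_sum]
  exact Finset.sum_le_sum fun k _ => key k

theorem absLambda2_set_finite {n : ℕ} (M : Matrix (Fin n) (Fin n) ℝ) :
    {r : ℝ | ∃ z ∈ spectrum ℂ (M.map Complex.ofReal), z ≠ 1 ∧ r = ‖z‖}.Finite := by
  refine ((M.map Complex.ofReal).finite_spectrum.image fun z => ‖z‖).subset ?_
  rintro r ⟨z, hz, -, rfl⟩
  exact ⟨z, hz, rfl⟩

theorem absLambda2_nonneg {n : ℕ} (M : Matrix (Fin n) (Fin n) ℝ) : 0 ≤ absLambda2 M := by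
  refine Real.sSup_nonneg ?_
  rintro r ⟨z, -, -, rfl⟩
  exact norm_nonneg z

/-- A real eigenvector is also a complex one, and finiteness of the spectrum makes the supremum an
upper bound. -/
theorem abs_le_absLambda2 {n : ℕ} {M : Matrix (Fin n) (Fin n) ℝ} {s : ℝ} {x : Fin n → ℝ}
    (hx : x ≠ 0) (h : M.mulVec x = s • x) (hs : s ≠ 1) : |s| ≤ absLambda2 M := by
  refine le_csSup (absLambda2_set_finite M).bddAbove ⟨(s : ℂ), ?_, ?_, ?_⟩
  · rw [← Matrix.spectrum_toLin', ← Module.End.hasEigenvalue_iff_mem_spectrum]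
    refine Module.End.hasEigenvalue_of_hasEigenvector (x := fun i => (x i : ℂ)) ⟨?_, ?_⟩
    · rw [Module.End.mem_eigenspace_iff, Matrix.toLin'_apply]
      funext i
      have hi := congrArg (fun y : ℝ => (y : ℂ)) (congrFun h i)
      simpa [Matrix.mulVec, dotProduct] using hi
    · intro h0
      exact hx (funext fun i => Complex.ofReal_eq_zero.mp (congrFun h0 i))
  · exact_mod_cast hs
  · rw [Complex.norm_real, Real.norm_eq_abs]

/-- A matrix that is symmetric for a weighted inner product has real spectrum. -/
theorem exists_real_eigenvector {n : ℕ} {m : Fin n → ℝ} (hm : ∀ i, 0 < m i)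
    {M : Matrix (Fin n) (Fin n) ℝ}
    (hsym : ∀ x y, ∑ i, m i * (y i * M.mulVec x i) = ∑ i, m i * (x i * M.mulVec y i))
    {z : ℂ} (hz : z ∈ spectrum ℂ (M.map Complex.ofReal)) :
    ∃ (s : ℝ) (x : Fin n → ℝ), z = s ∧ x ≠ 0 ∧ M.mulVec x = s • x := by
  rw [← Matrix.spectrum_toLin', ← Module.End.hasEigenvalue_iff_mem_spectrum] at hz
  obtain ⟨v, hv, hv0⟩ := hz.exists_hasEigenvector
  rw [Module.End.mem_eigenspace_iff, Matrix.toLin'_apply] at hv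
  set a : Fin n → ℝ := fun i => (v i).re with ha
  set b : Fin n → ℝ := fun i => (v i).im with hb
  have hMa : ∀ i, M.mulVec a i = z.re * a i - z.im * b i := fun i => by
    have hi := congrArg Complex.re (congrFun hv i)
    simpa [Matrix.mulVec, dotProduct] using hi
  have hMb : ∀ i, M.mulVec b i = z.re * b i + z.im * a i := fun i => by
    have hi := congrArg Complex.im (congrFun hv i)
    simpa [Matrix.mulVec, dotProduct] using hi
  have hab : a ≠ 0 ∨ b ≠ 0 := by
    by_contra! h
    exact hv0 (funext fun i => Complex.ext (congrFun h.1 i) (congrFun h.2 i))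
  have hpos : 0 < ∑ i, m i * (a i ^ 2 + b i ^ 2) := by
    obtain ⟨k, hk⟩ : ∃ k, 0 < a k ^ 2 + b k ^ 2 := by
      rcases hab with h | h
      · obtain ⟨k, hk⟩ := Function.ne_iff.mp h
        exact ⟨k, add_pos_of_pos_of_nonneg (sq_pos_of_ne_zero hk) (sq_nonneg _)⟩
      · obtain ⟨k, hk⟩ := Function.ne_iff.mp h
        exact ⟨k, add_pos_of_nonneg_of_pos (sq_nonneg _) (sq_pos_of_ne_zero hk)⟩
    exact Finset.sum_pos' (fun i _ => mul_nonneg (hm i).le (by positivity))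
      ⟨k, Finset.mem_univ _, mul_pos (hm k) hk⟩
  have him : z.im = 0 := by
    -- Symmetry tested on the imaginary and real parts of the eigenvector yields Im z times its
    -- squared weighted norm.
    have h := hsym b a
    rw [← sub_eq_zero, ← Finset.sum_sub_distrib] at h
    have e : ∑ i, (m i * (a i * M.mulVec b i) - m i * (b i * M.mulVec a i))
        = z.im * ∑ i, m i * (a i ^ 2 + b i ^ 2) := by
      rw [Finset.mul_sum]
      exact Finset.sum_congr rfl fun i _ => by rw [hMa, hMb]; ring
    rw [e] at h
    exact (mul_eq_zero.mp h).resolve_right hpos.ne'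
  have hzr : z = (z.re : ℂ) := Complex.ext rfl (by simpa using him)
  rcases hab with h | h
  · exact ⟨z.re, a, hzr, h, funext fun i => by simp [hMa, him]⟩
  · exact ⟨z.re, b, hzr, h, funext fun i => by simp [hMb, him]⟩

/-! ### Convergence of iterations: Lyapunov argument, linearization, root rate. -/

/-- LaSalle's invariance principle for a strict Lyapunov function. -/
theorem tendsto_of_strict_lyapunov {X : Type*} [MetricSpace X] {K : Set X} (hK : IsCompact K)
    {G : X → X} (hG : Continuous G) {V : X → ℝ} (hV : Continuous V) {x0 : X} (hx0 : G x0 = x0)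
    (hdec : ∀ x ∈ K, x ≠ x0 → V (G x) < V x) {u : ℕ → X} (hu : ∀ k, u (k + 1) = G (u k))
    (huK : ∀ k, u k ∈ K) : Tendsto u atTop (𝓝 x0) := by
  have hanti : Antitone fun k => V (u k) := by
    refine antitone_nat_of_succ_le fun k => ?_
    rw [hu]
    by_cases h : u k = x0
    · rw [h, hx0]
    · exact (hdec _ (huK k) h).le
  refine hK.tendsto_nhds_of_unique_mapClusterPt (Eventually.of_forall huK) fun y hy hcl => ?_
  by_contra hne
  obtain ⟨ψ, hψ, hlim⟩ := hcl.tendsto_subseq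
  -- At a cluster point y the monotone values V (u k) all tend to V y. The subsequence shifted by
  -- one gives V (G y) as well, so V (G y) = V y.
  have h1 : Tendsto (fun k => V (u (ψ k))) atTop (𝓝 (V y)) := (hV.tendsto y).comp hlim
  have h2 : Tendsto (fun k => V (u k)) atTop (𝓝 (V y)) :=
    (tendsto_iff_tendsto_subseq_of_antitone hanti hψ.tendsto_atTop).mpr h1
  have h3 : Tendsto (fun k => V (u (ψ k + 1))) atTop (𝓝 (V y)) :=
    h2.comp ((tendsto_add_atTop_nat 1).comp hψ.tendsto_atTop)
  have h4 : Tendsto (fun k => V (u (ψ k + 1))) atTop (𝓝 (V (G y))) := by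
    simp only [hu]
    exact ((hV.comp hG).tendsto y).comp hlim
  exact (hdec y hy hne).ne (tendsto_nhds_unique h4 h3)

/-- Local linear convergence, modulo the direction `e`, of the iteration of a map that commutes with
the translations along `e`, upgraded to convergence. -/
theorem linear_convergence_of_quotient {E V : Type*} [NormedAddCommGroup E] [NormedSpace ℝ E]
    [CompleteSpace E] [NormedAddCommGroup V] [NormedSpace ℝ V] {f : E → E} {J : E →L[ℝ] E}
    {p e : E} (hp : f p = p) (hJ : HasFDerivAt f J p)
    (he : ∀ (x : E) (t : ℝ), f (x + t • e) = f x + t • e) (φ : E →L[ℝ] ℝ) (hφ : φ e = 1)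
    (hφJ : ∀ x, φ x = 0 → φ (J x) = 0) (Φ : E ≃L[ℝ] V) {ρ : ℝ} (hρ0 : 0 ≤ ρ) (hρ1 : ρ < 1)
    (hΦ : ∀ x, φ x = 0 → ‖Φ (J x)‖ ≤ ρ * ‖Φ x‖) {u : ℕ → E} (hu : ∀ k, u (k + 1) = f (u k))
    (hd : Tendsto (fun k => u k - p - φ (u k - p) • e) atTop (𝓝 0)) :
    ∃ t : ℝ, Tendsto u atTop (𝓝 (p + t • e)) ∧
      ∀ r, ρ < r → r < 1 → ∃ C, ∀ᶠ k in atTop, ‖u k - (p + t • e)‖ ≤ C * r ^ k := by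
  set P : E →L[ℝ] E := ContinuousLinearMap.id ℝ E - φ.smulRight e with hP
  have hPx : ∀ x, P x = x - φ x • e := fun x => rfl
  have hPe : ∀ t : ℝ, P (t • e) = 0 := fun t => by simp [hPx, hφ]
  have hφP : ∀ x, φ (P x) = 0 := fun x => by simp [hPx, hφ]
  set d : ℕ → E := fun k => P (u k - p) with hdd
  have hd0 : Tendsto d atTop (𝓝 0) := hd
  set R : E → E := fun x => f (p + x) - p - J x with hR
  have hRo : R =o[𝓝 0] fun x => x := by
    have h := hasFDerivAt_iff_isLittleO_nhds_zero.mp hJ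
    rwa [hp] at h
  have hsplit : ∀ k, u k = p + d k + φ (u k - p) • e := fun k => by
    simp only [hdd, hPx]
    abel
  have hfu : ∀ k, u (k + 1) = p + J (d k) + R (d k) + φ (u k - p) • e := fun k => by
    rw [hu]
    conv_lhs => rw [hsplit k]
    have hRd : f (p + d k) = p + J (d k) + R (d k) := by
      simp only [hR]
      abel
    rw [he, hRd]
  have hstep : ∀ k, d (k + 1) = J (d k) + P (R (d k)) := fun k => by
    have h1 : u (k + 1) - p = J (d k) + R (d k) + φ (u k - p) • e := by
      rw [hfu]
      abel
    have h2 : P (J (d k)) = J (d k) := by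
      rw [hPx, hφJ _ (hφP _), zero_smul, sub_zero]
    change P (u (k + 1) - p) = _
    rw [h1, map_add, map_add, hPe, add_zero, h2]
  have hgeom : ∀ r, ρ < r → ∃ C, ∀ᶠ k in atTop, ‖d k‖ ≤ C * r ^ k := by
    intro r hr
    have hr0 : 0 < r := hρ0.trans_lt hr
    -- Measured through Φ, the remainder is eventually at most r - ρ times the error, which raises
    -- the contraction factor of J from ρ to r.
    have ho : (fun x => Φ (P (R x))) =o[𝓝 0] fun x => Φ x :=
      (((Φ : E →L[ℝ] V).comp P).isBigO_comp R _).trans_isLittleO hRo |>.trans_isBigO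
        (Φ.isBigO_comp_rev (fun x => x) _)
    have hev := hd0.eventually (ho.def (sub_pos.mpr hr))
    obtain ⟨N, hN⟩ := eventually_atTop.mp hev
    have hcontr : ∀ k ≥ N, ‖Φ (d (k + 1))‖ ≤ r * ‖Φ (d k)‖ := by
      intro k hk
      rw [hstep, map_add]
      refine (norm_add_le _ _).trans ?_
      have h1 := hΦ (d k) (hφP _)
      have h2 := hN k hk
      linarith
    have hpow : ∀ k, ‖Φ (d (N + k))‖ ≤ ‖Φ (d N)‖ * r ^ k := by
      intro k
      induction k with
      | zero => simp
      | succ k ih =>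
        calc ‖Φ (d (N + k + 1))‖ ≤ r * ‖Φ (d (N + k))‖ := hcontr _ (Nat.le_add_right _ _)
          _ ≤ r * (‖Φ (d N)‖ * r ^ k) := mul_le_mul_of_nonneg_left ih hr0.le
          _ = _ := by ring
    refine ⟨‖(Φ.symm : V →L[ℝ] E)‖ * ‖Φ (d N)‖ / r ^ N, eventually_atTop.mpr ⟨N, fun k hk => ?_⟩⟩
    obtain ⟨j, rfl⟩ := Nat.exists_eq_add_of_le hk
    calc ‖d (N + j)‖ = ‖(Φ.symm : V →L[ℝ] E) (Φ (d (N + j)))‖ := by simp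
      _ ≤ ‖(Φ.symm : V →L[ℝ] E)‖ * ‖Φ (d (N + j))‖ := ContinuousLinearMap.le_opNorm _ _
      _ ≤ ‖(Φ.symm : V →L[ℝ] E)‖ * (‖Φ (d N)‖ * r ^ j) :=
        mul_le_mul_of_nonneg_left (hpow j) (norm_nonneg _)
      _ = _ := by
        rw [pow_add]
        field_simp
  -- The e-components of u k and u (k + 1) cancel up to terms controlled by d k, so the full
  -- increments decay geometrically and u is Cauchy.
  have hincr : ∀ᶠ k in atTop, dist (u k) (u (k + 1)) ≤ (‖J‖ + 2) * ‖d k‖ := by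
    filter_upwards [hd0.eventually (hRo.def one_pos)] with k hk
    have h1 : u k - u (k + 1) = d k - J (d k) - R (d k) := by
      rw [hfu, sub_eq_iff_eq_add]
      exact (hsplit k).trans (by abel)
    rw [dist_eq_norm, h1]
    have h2 := J.le_opNorm (d k)
    have h3 := norm_sub_le (d k - J (d k)) (R (d k))
    have h4 := norm_sub_le (d k) (J (d k))
    linarith
  have hincr' : ∀ r, ρ < r → ∃ C, ∃ N, ∀ k, dist (u (k + N)) (u (k + 1 + N)) ≤ C * r ^ N * r ^ k := by
    intro r hr
    obtain ⟨C, hC⟩ := hgeom r hr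
    obtain ⟨N, hN⟩ := eventually_atTop.mp (hC.and hincr)
    refine ⟨(‖J‖ + 2) * C, N, fun k => ?_⟩
    obtain ⟨h1, h2⟩ := hN (k + N) (Nat.le_add_left _ _)
    have h3 : k + 1 + N = k + N + 1 := by ring
    rw [h3]
    calc _ ≤ _ := h2
      _ ≤ (‖J‖ + 2) * (C * r ^ (k + N)) := mul_le_mul_of_nonneg_left h1 (by positivity)
      _ = _ := by ring
  obtain ⟨w, hw⟩ : ∃ w, Tendsto u atTop (𝓝 w) := by
    obtain ⟨r, hr, hr1⟩ := exists_between hρ1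
    obtain ⟨C, N, hCN⟩ := hincr' r hr
    obtain ⟨w, hw⟩ := cauchySeq_tendsto_of_complete (cauchySeq_of_le_geometric r _ hr1 hCN)
    exact ⟨w, (tendsto_add_atTop_iff_nat N).mp hw⟩
  have hwe : w = p + φ (w - p) • e := by
    have h1 : Tendsto d atTop (𝓝 (P (w - p))) :=
      (P.continuous.tendsto _).comp (hw.sub_const p)
    have h2 := tendsto_nhds_unique h1 hd0
    rw [hPx, sub_eq_zero, sub_eq_iff_eq_add'] at h2
    exact h2
  refine ⟨φ (w - p), hwe ▸ hw, fun r hr hr1 => ?_⟩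
  rw [← hwe]
  obtain ⟨C, N, hCN⟩ := hincr' r hr
  refine ⟨C / (1 - r), eventually_atTop.mpr ⟨N, fun k hk => ?_⟩⟩
  obtain ⟨j, rfl⟩ := Nat.exists_eq_add_of_le' hk
  have h := dist_le_of_le_geometric_of_tendsto r _ hr1 hCN ((tendsto_add_atTop_iff_nat N).mpr hw) j
  rw [dist_eq_norm] at h
  refine h.trans (le_of_eq ?_)
  rw [pow_add]
  ring

/-- A geometric bound on the error bounds the root convergence rate. -/
theorem limsup_rpow_inv_le {a : ℕ → ℝ} {r C : ℝ} (ha : ∀ k, 0 ≤ a k) (hr : 0 < r)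
    (h : ∀ᶠ k in atTop, a k ≤ C * r ^ k) :
    limsup (fun k : ℕ => ENNReal.ofReal (a k ^ (1 / (k : ℝ)))) atTop ≤ ENNReal.ofReal r := by
  -- The constant is made positive so that its k-th roots tend to 1.
  have hC : 0 < max C 1 := lt_max_of_lt_right one_pos
  have hlim : Tendsto (fun k : ℕ => ENNReal.ofReal (max C 1 ^ (1 / (k : ℝ)) * r)) atTop
      (𝓝 (ENNReal.ofReal r)) := by
    refine ENNReal.tendsto_ofReal ?_
    have h1 : Tendsto (fun k : ℕ => max C 1 ^ (1 / (k : ℝ))) atTop (𝓝 (max C 1 ^ (0 : ℝ))) :=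
      (Real.continuous_const_rpow hC.ne').continuousAt.tendsto.comp
        tendsto_one_div_atTop_nhds_zero_nat
    rw [Real.rpow_zero] at h1
    simpa using h1.mul_const r
  rw [← hlim.limsup_eq]
  refine limsup_le_limsup ?_
  filter_upwards [h, eventually_gt_atTop 0] with k hk hk0
  refine ENNReal.ofReal_le_ofReal ?_
  have hk' : (k : ℝ) ≠ 0 := Nat.cast_ne_zero.mpr hk0.ne'
  calc a k ^ (1 / (k : ℝ)) ≤ (max C 1 * r ^ k) ^ (1 / (k : ℝ)) :=
        Real.rpow_le_rpow (ha k)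
          (hk.trans (mul_le_mul_of_nonneg_right (le_max_left _ _) (pow_pos hr k).le))
          (by positivity)
    _ = max C 1 ^ (1 / (k : ℝ)) * r := by
        rw [Real.mul_rpow hC.le (pow_pos hr k).le, ← Real.rpow_natCast r k, ← Real.rpow_mul hr.le,
          mul_one_div_cancel hk', Real.rpow_one]

/-! ### Convergence of the HOTS iteration and its rate. -/

section Convergence

variable {n : ℕ} {A : Matrix (Fin n) (Fin n) ℝ} {α : ℝ}

theorem jacobianF_mulVec (A : Matrix (Fin n) (Fin n) ℝ) (α : ℝ) (p x : Fin n → ℝ) :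
    (jacobianF A α p).mulVec x = fderiv ℝ (F A α) p x := by
  have e : jacobianF A α p = LinearMap.toMatrix' (fderiv ℝ (F A α) p : (Fin n → ℝ) →ₗ[ℝ] _) := by
    ext i j
    rw [LinearMap.toMatrix'_apply]
    rfl
  rw [e, LinearMap.toMatrix'_mulVec]
  rfl

/-- The Rayleigh quotient of an eigenvector is its eigenvalue, so the two bounds on the quadratic
form apply. -/
theorem eigenvalue_mem_of_fixed (hA : ∀ i j, 0 ≤ A i j) (hA0 : A ≠ 0) (h1 : 1 / 2 < α)
    (h2 : α < 1) {p : Fin n → ℝ} (hp : F A α p = p) {s : ℝ} {x : Fin n → ℝ} (hx : x ≠ 0)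
    (h : fderiv ℝ (F A α) p x = s • x) : -1 < s ∧ s ≤ 1 := by
  have hm := nodeFlow_pos hA hA0 h1 h2 p
  have hpos : 0 < ∑ i, nodeFlow A α p i * x i ^ 2 := by
    obtain ⟨k, hk⟩ := Function.ne_iff.mp hx
    exact Finset.sum_pos' (fun i _ => mul_nonneg (hm i).le (sq_nonneg _))
      ⟨k, Finset.mem_univ _, mul_pos (hm k) (sq_pos_of_ne_zero hk)⟩
  have e : ∑ i, nodeFlow A α p i * (x i * fderiv ℝ (F A α) p x i)
      = s * ∑ i, nodeFlow A α p i * x i ^ 2 := by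
    rw [h, Finset.mul_sum]
    refine Finset.sum_congr rfl fun i _ => ?_
    simp only [Pi.smul_apply, smul_eq_mul]
    ring
  have u := (sum_nodeFlow_mul_fderiv_le hA hA0 h1 h2 hp x).1
  have l := neg_lt_sum_nodeFlow_mul_fderiv hA hA0 h1 h2 hp hx
  rw [e] at u l
  constructor <;> nlinarith

theorem absLambda2_lt_one (hA : ∀ i j, 0 ≤ A i j) (hA0 : A ≠ 0) (h1 : 1 / 2 < α)
    (h2 : α < 1) {p : Fin n → ℝ} (hp : F A α p = p) : absLambda2 (jacobianF A α p) < 1 := by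
  unfold absLambda2
  rcases Set.eq_empty_or_nonempty
    {r : ℝ | ∃ z ∈ spectrum ℂ ((jacobianF A α p).map Complex.ofReal), z ≠ 1 ∧ r = ‖z‖} with h | h
  · rw [h, Real.sSup_empty]
    exact one_pos
  · rw [(absLambda2_set_finite _).csSup_lt_iff h]
    rintro r ⟨z, hz, hz1, rfl⟩
    obtain ⟨s, x, rfl, hx, hs⟩ := exists_real_eigenvector (nodeFlow_pos hA hA0 h1 h2 p)
      (fun x y => by
        simp only [jacobianF_mulVec]
        exact sum_nodeFlow_mul_fderiv_comm hA hA0 h1 h2 hp x y) hz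
    rw [jacobianF_mulVec] at hs
    obtain ⟨hl, hu⟩ := eigenvalue_mem_of_fixed hA hA0 h1 h2 hp hx hs
    rw [Complex.norm_real, Real.norm_eq_abs, abs_lt]
    exact ⟨hl, lt_of_le_of_ne hu fun h => hz1 (by simp [h])⟩

/-- At a fixed point `∇F` contracts the complement of the constants by the factor `|λ₂|`. -/
theorem norm_weightedEquiv_fderiv_le (hA : ∀ i j, 0 ≤ A i j) (hA0 : A ≠ 0) (h1 : 1 / 2 < α)
    (h2 : α < 1) {p : Fin n → ℝ} (hp : F A α p = p) {x : Fin n → ℝ}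
    (hx : ∑ i, nodeFlow A α p i * x i = 0) :
    ‖weightedEquiv _ (nodeFlow_pos hA hA0 h1 h2 p) (fderiv ℝ (F A α) p x)‖
      ≤ absLambda2 (jacobianF A α p) * ‖weightedEquiv _ (nodeFlow_pos hA hA0 h1 h2 p) x‖ := by
  have hsym := sum_nodeFlow_mul_fderiv_comm hA hA0 h1 h2 hp
  have hone : ∀ y, fderiv ℝ (F A α) p y = y → ∃ t : ℝ, ∀ i, y i = t := by
    intro y hy
    refine (sum_nodeFlow_mul_fderiv_le hA hA0 h1 h2 hp y).2 (le_of_eq ?_)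
    rw [hy]
    exact Finset.sum_congr rfl fun i _ => by rw [sq]
  have hle : ∀ (s : ℝ) (y : Fin n → ℝ), y ≠ 0 → fderiv ℝ (F A α) p y = s • y → s ≠ 1 →
      |s| ≤ absLambda2 (jacobianF A α p) := fun s y hy h hs =>
    abs_le_absLambda2 hy (by rw [jacobianF_mulVec]; exact h) hs
  have h0 := absLambda2_nonneg (jacobianF A α p)
  generalize absLambda2 (jacobianF A α p) = r at *
  generalize fderiv ℝ (F A α) p = J at *
  exact norm_weightedEquiv_apply_le (nodeFlow_pos hA hA0 h1 h2 p) J.toLinearMap hsym hone h0 hle hx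

/-- The mean of the coordinates with respect to weights. -/
def weightedMean (m : Fin n → ℝ) : (Fin n → ℝ) →L[ℝ] ℝ :=
  (∑ i, m i)⁻¹ • ∑ i, m i • ContinuousLinearMap.proj i

theorem weightedMean_apply (m x : Fin n → ℝ) :
    weightedMean m x = (∑ i, m i)⁻¹ * ∑ i, m i * x i := by
  simp [weightedMean]

theorem F_add_smul_one (hA : ∀ i j, 0 ≤ A i j) (hA0 : A ≠ 0) (h1 : 1 / 2 < α) (h2 : α < 1)
    (p : Fin n → ℝ) (t : ℝ) :
    F A α (p + t • (1 : Fin n → ℝ)) = F A α p + t • (1 : Fin n → ℝ) := by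
  have e : ∀ q : Fin n → ℝ, q + t • (1 : Fin n → ℝ) = fun i => q i + t := fun q => by
    funext i
    simp
  rw [e, e, F_add_const hA hA0 h1 h2]

theorem dual_add_smul_one (hA0 : A ≠ 0) (p : Fin n → ℝ) (t : ℝ) :
    dual A α (p + t • (1 : Fin n → ℝ)) = dual A α p := by
  rw [← dual_add_const hA0 p t]
  congr 1
  funext i
  simp

theorem fderiv_F_one (hA : ∀ i j, 0 ≤ A i j) (hA0 : A ≠ 0) (h1 : 1 / 2 < α) (h2 : α < 1)
    (p : Fin n → ℝ) : fderiv ℝ (F A α) p 1 = 1 := by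
  have hline : ∀ q : Fin n → ℝ, HasDerivAt (fun t : ℝ => q + t • (1 : Fin n → ℝ)) 1 0 := fun q => by
    simpa using ((hasDerivAt_id (0 : ℝ)).smul_const (1 : Fin n → ℝ)).const_add q
  have hF : HasFDerivAt (F A α) (fderiv ℝ (F A α) p) (p + (0 : ℝ) • (1 : Fin n → ℝ)) := by
    rw [zero_smul, add_zero]
    exact (differentiable_F hA hA0 h1 h2 p).hasFDerivAt
  have h := hF.comp_hasDerivAt 0 (hline p)
  have e : (F A α ∘ fun t : ℝ => p + t • (1 : Fin n → ℝ))
      = fun t : ℝ => F A α p + t • (1 : Fin n → ℝ) :=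
    funext fun t => F_add_smul_one hA hA0 h1 h2 p t
  rw [e] at h
  exact h.unique (hline _)

/-- The limit is a translate, depending on the starting point, of the fixed point used for the
analysis; the rate must be the same at both. -/
theorem jacobianF_add_smul_one (hA : ∀ i j, 0 ≤ A i j) (hA0 : A ≠ 0) (h1 : 1 / 2 < α)
    (h2 : α < 1) (p : Fin n → ℝ) (t : ℝ) :
    jacobianF A α (p + t • (1 : Fin n → ℝ)) = jacobianF A α p := by
  have h : fderiv ℝ (F A α) (p + t • (1 : Fin n → ℝ)) = fderiv ℝ (F A α) p := by
    rw [← fderiv_comp_add_right (t • (1 : Fin n → ℝ))]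
    simp only [F_add_smul_one hA hA0 h1 h2]
    exact fderiv_add_const _
  unfold jacobianF
  rw [h]

/-- The algorithm converges modulo constants. -/
theorem tendsto_centered_iterate (hA : ∀ i j, 0 ≤ A i j) (h1 : 1 / 2 < α) (h2 : α < 1)
    (hflow : ∃ ρ : Matrix (Fin n ⊕ Unit) (Fin n ⊕ Unit) ℝ,
      IsFeasibleFlow α ρ ∧ SamePattern ρ (augmented A)) {p : Fin n → ℝ} (hp : F A α p = p)
    {m : Fin n → ℝ} (hm : ∀ i, 0 < m i) (hm1 : weightedMean m 1 = 1) (q : Fin n → ℝ) :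
    Tendsto (fun k => (F A α)^[k] q - p - weightedMean m ((F A α)^[k] q - p) • (1 : Fin n → ℝ))
      atTop (𝓝 0) := by
  have hA0 : A ≠ 0 := by
    obtain ⟨ρ, hρ, hs⟩ := hflow
    exact ne_zero_of_flow h1 hρ hs
  obtain ⟨i0⟩ : Nonempty (Fin n) := Finset.univ_nonempty_iff.mp (nonempty_of_ne_zero hA0)
  have hM : 0 < ∑ i, m i := Finset.sum_pos (fun i _ => hm i) ⟨i0, Finset.mem_univ _⟩
  obtain ⟨R, hR⟩ := exists_sub_le_of_dual_le hA h1 h2 hflow (dual A α q)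
  set φ := weightedMean m with hφ
  have hφc : ∀ (x : Fin n → ℝ) (t : ℝ), φ (x + t • (1 : Fin n → ℝ)) = φ x + t := fun x t => by
    simp [hm1]
  set w : ℕ → Fin n → ℝ := fun k => (F A α)^[k] q with hw
  have hwk : ∀ k, w (k + 1) = F A α (w k) := fun k => Function.iterate_succ_apply' _ _ _
  set P : (Fin n → ℝ) → Fin n → ℝ := fun x => x - φ x • (1 : Fin n → ℝ) with hP
  have hPc : ∀ (x : Fin n → ℝ) (t : ℝ), P (x + t • (1 : Fin n → ℝ)) = P x := fun x t => by
    simp only [hP, hφc, add_smul]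
    abel
  have hφP : ∀ x, φ (P x) = 0 := fun x => by simp [hP, hm1]
  have hPcont : Continuous P := by
    simp only [hP]
    fun_prop
  have hFcont := (differentiable_F hA hA0 h1 h2).continuous
  have hdual : ∀ k, dual A α (w k) ≤ dual A α q := by
    intro k
    induction k with
    | zero => exact le_rfl
    | succ k ih =>
      rw [hwk]
      by_cases h : F A α (w k) = w k
      · rwa [h]
      · exact (dual_F_lt hA hA0 h1 h2 h).le.trans ih
  -- The quotient by constants is realized as the slice of weighted mean zero around p, with G the
  -- recentred step. In this slice 0 is the only fixed point.
  refine tendsto_of_strict_lyapunov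
    (K := Metric.closedBall 0 (R + 2 * ‖p‖) ∩ {x | φ x = 0})
    ((isCompact_closedBall _ _).inter_right (isClosed_eq φ.continuous continuous_const))
    (G := fun x => P (F A α (p + x) - p)) (V := fun x => dual A α (p + x))
    (by fun_prop) ((continuous_dual hA hA0 α).comp (by fun_prop)) ?_ ?_ ?_ ?_
  · simp [hp, hP]
  · rintro x ⟨-, hx⟩ hx0
    have hne : F A α (p + x) ≠ p + x := by
      intro hfix
      obtain ⟨t, ht⟩ := (fixed_iff_add_const hA hA0 h1 h2 hp _).mp hfix
      have hxt : x = t • (1 : Fin n → ℝ) := by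
        funext i
        have := congrFun ht i
        simpa using this
      have ht0 : t = 0 := by
        have h : φ x = 0 := hx
        rw [hxt] at h
        simpa [hm1] using h
      exact hx0 (by rw [hxt, ht0, zero_smul])
    have e : p + P (F A α (p + x) - p)
        = F A α (p + x) + (-φ (F A α (p + x) - p)) • (1 : Fin n → ℝ) := by
      simp only [hP, neg_smul]
      abel
    change dual A α (p + P (F A α (p + x) - p)) < dual A α (p + x)
    rw [e, dual_add_smul_one hA0]
    exact dual_F_lt hA hA0 h1 h2 hne
  · intro k
    change P (w (k + 1) - p) = P (F A α (p + P (w k - p)) - p)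
    have e : w k = p + P (w k - p) + φ (w k - p) • (1 : Fin n → ℝ) := by
      simp only [hP]
      abel
    have e2 : F A α (w k) - p
        = F A α (p + P (w k - p)) - p + φ (w k - p) • (1 : Fin n → ℝ) := by
      conv_lhs => rw [e, F_add_smul_one hA hA0 h1 h2]
      abel
    rw [hwk, e2, hPc]
  · intro k
    change P (w k - p) ∈ _
    refine ⟨?_, hφP _⟩
    set x := P (w k - p) with hx
    have hdiff : ∀ i j, |x i - x j| ≤ R + 2 * ‖p‖ := by
      intro i j
      have e : x i - x j = (w k i - w k j) - (p i - p j) := by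
        simp only [hx, hP, Pi.sub_apply, Pi.smul_apply, Pi.one_apply]
        ring
      have b1 := hR _ (hdual k) i j
      have b2 := norm_le_pi_norm p i
      have b3 := norm_le_pi_norm p j
      rw [Real.norm_eq_abs] at b2 b3
      rw [e]
      have b4 := abs_sub (w k i - w k j) (p i - p j)
      have b5 := abs_sub (p i) (p j)
      linarith
    have hR0 : 0 ≤ R + 2 * ‖p‖ := (abs_nonneg _).trans (hdiff i0 i0)
    rw [mem_closedBall_zero_iff, pi_norm_le_iff_of_nonneg hR0]
    intro i
    have h0 : ∑ j, m j * x j = 0 := by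
      have h := hφP (w k - p)
      rw [← hx, hφ, weightedMean_apply] at h
      exact (mul_eq_zero.mp h).resolve_left (inv_ne_zero hM.ne')
    -- With mean zero each coordinate is an average of differences, so the oscillation bounds the
    -- norm.
    have h3 : (∑ j, m j) * x i = ∑ j, m j * (x i - x j) := by
      simp only [mul_sub, Finset.sum_sub_distrib, h0, sub_zero, Finset.sum_mul]
    have h4 : |(∑ j, m j) * x i| ≤ (∑ j, m j) * (R + 2 * ‖p‖) := by
      rw [h3, Finset.sum_mul]
      refine (Finset.abs_sum_le_sum_abs _ _).trans (Finset.sum_le_sum fun j _ => ?_)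
      rw [abs_mul, abs_of_pos (hm j)]
      exact mul_le_mul_of_nonneg_left (hdiff i j) (hm j).le
    rw [abs_mul, abs_of_pos hM] at h4
    exact le_of_mul_le_mul_left h4 hM

/-- The logarithmic form of the algorithm converges linearly to a fixed point of `F`. -/
theorem iterate_F_linear_convergence (hA : ∀ i j, 0 ≤ A i j) (h1 : 1 / 2 < α) (h2 : α < 1)
    (hflow : ∃ ρ : Matrix (Fin n ⊕ Unit) (Fin n ⊕ Unit) ℝ,
      IsFeasibleFlow α ρ ∧ SamePattern ρ (augmented A)) (q : Fin n → ℝ) :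
    ∃ p, F A α p = p ∧ absLambda2 (jacobianF A α p) < 1 ∧
      Tendsto (fun k => (F A α)^[k] q) atTop (𝓝 p) ∧
      ∀ r, absLambda2 (jacobianF A α p) < r → r < 1 →
        ∃ C, ∀ᶠ k in atTop, ‖(F A α)^[k] q - p‖ ≤ C * r ^ k := by
  have hA0 : A ≠ 0 := by
    obtain ⟨ρ, hρ, hs⟩ := hflow
    exact ne_zero_of_flow h1 hρ hs
  obtain ⟨p, hp⟩ := exists_fixed hA h1 h2 hflow
  have hm := nodeFlow_pos hA hA0 h1 h2 p
  have hM : 0 < ∑ i, nodeFlow A α p i :=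
    Finset.sum_pos (fun i _ => hm i) (nonempty_of_ne_zero hA0)
  have hm1 : weightedMean (nodeFlow A α p) 1 = 1 := by
    simp only [weightedMean_apply, Pi.one_apply, mul_one]
    exact inv_mul_cancel₀ hM.ne'
  have hker : ∀ x, weightedMean (nodeFlow A α p) x = 0 → ∑ i, nodeFlow A α p i * x i = 0 := by
    intro x hx
    rw [weightedMean_apply] at hx
    exact (mul_eq_zero.mp hx).resolve_left (inv_ne_zero hM.ne')
  have hinv : ∀ x, weightedMean (nodeFlow A α p) x = 0 →
      weightedMean (nodeFlow A α p) (fderiv ℝ (F A α) p x) = 0 := by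
    intro x hx
    -- Since ∇F fixes the constants and is self-adjoint, it preserves their orthogonal complement.
    have h := sum_nodeFlow_mul_fderiv_comm hA hA0 h1 h2 hp x 1
    simp only [fderiv_F_one hA hA0 h1 h2, Pi.one_apply, one_mul, mul_one] at h
    rw [weightedMean_apply, h, hker x hx, mul_zero]
  obtain ⟨t, ht, hrate⟩ := linear_convergence_of_quotient hp
    (differentiable_F hA hA0 h1 h2 p).hasFDerivAt (F_add_smul_one hA hA0 h1 h2)
    (weightedMean (nodeFlow A α p)) hm1 hinv (weightedEquiv _ hm) (absLambda2_nonneg _)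
    (absLambda2_lt_one hA hA0 h1 h2 hp)
    (fun x hx => norm_weightedEquiv_fderiv_le hA hA0 h1 h2 hp (hker x hx))
    (u := fun k => (F A α)^[k] q) (fun k => Function.iterate_succ_apply' _ _ _)
    (tendsto_centered_iterate hA h1 h2 hflow hp hm hm1 q)
  refine ⟨p + t • (1 : Fin n → ℝ), ?_, ?_, ht, ?_⟩
  · rw [F_add_smul_one hA hA0 h1 h2, hp]
  · rw [jacobianF_add_smul_one hA hA0 h1 h2]
    exact absLambda2_lt_one hA hA0 h1 h2 hp
  · rw [jacobianF_add_smul_one hA hA0 h1 h2]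
    exact hrate

/-- Linear convergence in logarithmic coordinates gives linear convergence of the exponentials. -/
theorem convergesLinearly_exp {u : ℕ → Fin n → ℝ} {p : Fin n → ℝ} {ρ : ℝ} (hρ0 : 0 ≤ ρ)
    (hρ1 : ρ < 1) (hu : Tendsto u atTop (𝓝 p))
    (hrate : ∀ r, ρ < r → r < 1 → ∃ C, ∀ᶠ k in atTop, ‖u k - p‖ ≤ C * r ^ k) :
    ConvergesLinearly (fun k i => Real.exp (u k i)) (fun i => Real.exp (p i)) ρ := by
  set E : (Fin n → ℝ) → Fin n → ℝ := fun x i => Real.exp (x i) with hE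
  have hEd : Differentiable ℝ E := by
    rw [differentiable_pi]
    intro i
    fun_prop
  refine ⟨hρ1, (hEd.continuous.tendsto p).comp hu, ?_⟩
  obtain ⟨c, hc⟩ := (hEd p).hasFDerivAt.isBigO_sub.bound
  have hbound : ∀ r, ρ < r → r < 1 →
      limsup (fun k : ℕ => ENNReal.ofReal (‖E (u k) - E p‖ ^ (1 / (k : ℝ)))) atTop
        ≤ ENNReal.ofReal r := by
    intro r hr hr1
    obtain ⟨C, hC⟩ := hrate r hr hr1
    refine limsup_rpow_inv_le (C := max c 0 * C) (fun k => norm_nonneg _) (hρ0.trans_lt hr) ?_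
    filter_upwards [hC, hu.eventually hc] with k hk1 hk2
    calc ‖E (u k) - E p‖ ≤ c * ‖u k - p‖ := hk2
      _ ≤ max c 0 * ‖u k - p‖ := mul_le_mul_of_nonneg_right (le_max_left _ _) (norm_nonneg _)
      _ ≤ max c 0 * (C * r ^ k) := mul_le_mul_of_nonneg_left hk1 (le_max_right _ _)
      _ = _ := by ring
  have hlim : Tendsto ENNReal.ofReal (𝓝[>] ρ) (𝓝 (ENNReal.ofReal ρ)) :=
    (ENNReal.continuous_ofReal.tendsto ρ).mono_left nhdsWithin_le_nhds
  -- The bound is known only for r strictly above ρ; letting r decrease to ρ gives the stated rate.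
  refine ge_of_tendsto hlim ?_
  filter_upwards [Ioo_mem_nhdsGT hρ1] with r hr
  exact hbound r hr.1 hr.2

end Convergence

end Hots

end

theorem theorem4p2 (n : ℕ) (A : Matrix (Fin n) (Fin n) ℝ) (hA : ∀ i j, 0 ≤ A i j)
    (α : ℝ) (hα : 1 / 2 < α) (hα' : α < 1)
    (hflow : ∃ ρ : Matrix (Fin n ⊕ Unit) (Fin n ⊕ Unit) ℝ,
      Hots.IsFeasibleFlow α ρ ∧ Hots.SamePattern ρ (Hots.augmented A)) :
    -- existence and uniqueness of the HOTS vector up to a positive multiplicative constant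
    (∃ y, Hots.IsHotsVector A α y) ∧
    (∀ y, Hots.IsHotsVector A α y → ∀ z, Hots.IsHotsVector A α z ↔ ∃ c : ℝ, 0 < c ∧ z = c • y) ∧
    -- the HOTS vectors are the exponentials of the fixed points of `F`
    (∀ p : Fin n → ℝ, Hots.IsHotsVector A α (fun i => Real.exp (p i)) ↔ Hots.F A α p = p) ∧
    -- linear convergence of the algorithm to a HOTS vector
    (∀ y0 : Fin n → ℝ, (∀ i, 0 < y0 i) →
      ∃ p : Fin n → ℝ, Hots.IsHotsVector A α (fun i => Real.exp (p i)) ∧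
        DifferentiableAt ℝ (Hots.F A α) p ∧
        Hots.ConvergesLinearly (Hots.iterates A α y0) (fun i => Real.exp (p i))
          (Hots.absLambda2 (Hots.jacobianF A α p))) := by
  have hA0 : A ≠ 0 := by
    obtain ⟨ρ, hρ, hs⟩ := hflow
    exact Hots.ne_zero_of_flow hα hρ hs
  have hfix : ∀ p : Fin n → ℝ,
      Hots.IsHotsVector A α (fun i => Real.exp (p i)) ↔ Hots.F A α p = p := fun p =>
    (Hots.isHotsVector_exp_iff hA hA0 hα hα' p).trans (Hots.forall_dual_le_iff hA hA0 hα hα' p)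
  have hexp : ∀ y : Fin n → ℝ, (∀ i, 0 < y i) →
      ∃ p : Fin n → ℝ, y = fun i => Real.exp (p i) := fun y hy =>
    ⟨fun i => Real.log (y i), funext fun i => (Real.exp_log (hy i)).symm⟩
  refine ⟨?_, ?_, hfix, ?_⟩
  · obtain ⟨p, hp⟩ := Hots.exists_fixed hA hα hα' hflow
    exact ⟨_, (hfix p).mpr hp⟩
  · intro y hy z
    obtain ⟨p, rfl⟩ := hexp y hy.1
    have hp := (hfix p).mp hy
    constructor
    · intro hz
      obtain ⟨q, rfl⟩ := hexp z hz.1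
      obtain ⟨t, rfl⟩ := (Hots.fixed_iff_add_const hA hA0 hα hα' hp q).mp ((hfix q).mp hz)
      refine ⟨Real.exp t, Real.exp_pos t, funext fun i => ?_⟩
      rw [Pi.smul_apply, smul_eq_mul, ← Real.exp_add, add_comm]
    · rintro ⟨c, hc, rfl⟩
      have e : (c • fun i => Real.exp (p i)) = fun i => Real.exp (p i + Real.log c) := by
        funext i
        rw [Pi.smul_apply, smul_eq_mul, Real.exp_add, Real.exp_log hc, mul_comm]
      rw [e, hfix]
      exact (Hots.fixed_iff_add_const hA hA0 hα hα' hp _).mpr ⟨_, rfl⟩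
  · intro y0 hy0
    obtain ⟨q, rfl⟩ := hexp y0 hy0
    obtain ⟨p, hp, hlt, hlim, hrate⟩ := Hots.iterate_F_linear_convergence hA hα hα' hflow q
    refine ⟨p, (hfix p).mpr hp, Hots.differentiable_F hA hA0 hα hα' p, ?_⟩
    have h := Hots.convergesLinearly_exp (Hots.absLambda2_nonneg _) hlt hlim hrate
    have e : Hots.iterates A α (fun i => Real.exp (q i))
        = fun k i => Real.exp ((Hots.F A α)^[k] q i) :=
      funext fun k => Hots.iterates_exp hA hA0 hα hα' q k
    rwa [e]
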